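/- Let $N\ge 0$ and let $W\in\mathbb C[x]$ be homogeneous of degree $N+1$, regarded as a superpotential on $V=\mathbb C$. Let $$\mathrm{Obs}=\mathbb C[\gamma_{n_1,n_2}]_{n_1,n_2\ge 0}\otimes\Lambda[\beta_{n_1,n_2}]_{n_1,n_2\ge 0}$$ be the algebra of holomorphic local operators at $0$ of the $\beta\gamma$ system on $\mathbb C^2$ with values in $V$, where $\gamma_{n_1,n_2}$ (even) is the operator $\gamma\mapsto\partial_1^{n_1}\partial_2^{n_2}\gamma(0)$ and $\beta_{n_1,n_2}$ (odd) is the operator $\beta\,d^2z\mapsto\partial_1^{n_1}\partial_2^{n_2}\beta(0)$. Equip it with the interaction differential $s_{\rm int}$: the odd derivation with $s_{\rm int}\gamma_{n_1,n_2}=0$ and $$s_{\rm int}\beta_{n_1,n_2}=\partial_1^{n_1}\partial_2^{n_2}\bigl(W'(\gamma(z))\bigr)\big|_{z=0},\qquad \gamma(z)=\sum_{n_1,n_2\ge0}\gamma_{n_1,n_2}\frac{z_1^{n_1}z_2^{n_2}}{n_1!\,n_2!}.$$ The group $SU(2)\times U(1)_q\times U(1)_z$ acts on $\mathrm{Obs}$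 by automorphisms commuting with $s_{\rm int}$: it acts on the derivatives $\partial_1,\partial_2$ through the fundamental representation of $SU(2)$; each derivative has $q$-weight $1$; and in addition $\gamma$ and $\beta$ have $z$-weights $1$ and $N$. Thus, with $p$ denoting $\mathrm{diag}(p,p^{-1})\in SU(2)$, the operators $\gamma_{n_1,n_2}$ and $\beta_{n_1,n_2}$ have torus weights $z\,q^{n_1+n_2}p^{n_1-n_2}$ and $z^N q^{n_1+n_2}p^{n_1-n_2}$. For a $\mathbb Z/2$-graded representation $E=E_0\oplus E_1$ of this group that is the sum of its finite-dimensional weight spaces $E^{(j,m,k)}$ for the maximal torus (weight $p^jq^mz^k$), the character is the formal series $\sum_{j,m,k}\bigl(\dim E_0^{(j,m,k)}-\dim E_1^{(j,m,k)}\bigr)p^jq^mz^k$. Then the product $$\chi_W(p,q;z)=\prod_{m\ge 0}\prod_{\ell=0}^m\frac{1-z^Nq^mp^{2\ell-m}}{1-zq^mp^{2\ell-m}}$$ converges in $\mathbb Z[p,p^{-1}][[q,z]]$ (coefficientwise). Both $\mathrm{Obs}$ and the cohomology $H^*(\mathrm{Obs},s_{\rm int})$, with the parity grading and the action induced from $\mathrm{Obs}$,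 are sums of finite-dimensional weight spaces with non-negative exponents of $q$ and $z$, and the character of each of them equals $\chi_W(p,q;z)$. -/

import Mathlib

open scoped LaurentPolynomial MvPowerSeries.WithPiTopology

namespace HolomorphicTwist

section ExteriorSemilinear

variable {A M : Type*} [CommRing A] [AddCommGroup M] [Module A M]

/-- The exterior algebra, with its scalars acting through the ring endomorphism `σ`. -/
def TwistedExterior (M : Type*) [AddCommGroup M] [Module A M] (_σ : A →+* A) : Type _ :=
  ExteriorAlgebra A M

noncomputable instance (σ : A →+* A) : Ring (TwistedExterior M σ) :=
  inferInstanceAs (Ring (ExteriorAlgebra A M))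

noncomputable instance (σ : A →+* A) : Algebra A (TwistedExterior M σ) :=
  RingHom.toAlgebra' ((algebraMap A (ExteriorAlgebra A M)).comp σ)
    (fun c x => Algebra.commutes (σ c) (show ExteriorAlgebra A M from x))

/-- The ring endomorphism of an exterior algebra induced by a semilinear endomorphism of
its generating module: `a ↦ σ a` on scalars and `v ↦ f v` on generators. -/
noncomputable def exteriorMap (σ : A →+* A) (f : M →ₛₗ[σ] M) :
    ExteriorAlgebra A M →+* ExteriorAlgebra A M :=
  (ExteriorAlgebra.lift A (A := TwistedExterior M σ)
    ⟨{ toFun := fun v => (ExteriorAlgebra.ι A (f v) : ExteriorAlgebra A M)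
       map_add' := fun v w => by
        rw [map_add, map_add]; rfl
       map_smul' := fun a v => by
        rw [map_smulₛₗ, map_smul, Algebra.smul_def]; rfl },
      fun v => ExteriorAlgebra.ι_sq_zero (R := A) (f v)⟩).toRingHom

theorem exteriorMap_algebraMap (σ : A →+* A) (f : M →ₛₗ[σ] M) (a : A) :
    exteriorMap σ f (algebraMap A _ a) = algebraMap A _ (σ a) :=
  AlgHom.commutes (ExteriorAlgebra.lift A (A := TwistedExterior M σ) _) a

theorem exteriorMap_ι (σ : A →+* A) (f : M →ₛₗ[σ] M) (v : M) :
    exteriorMap σ f (ExteriorAlgebra.ι A v) = ExteriorAlgebra.ι A (f v) :=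
  ExteriorAlgebra.lift_ι_apply (R := A) (A := TwistedExterior M σ) _ _ v

theorem exterior_ringHom_ext {B : Type*} [Ring B] {F G : ExteriorAlgebra A M →+* B}
    (h₁ : ∀ a : A, F (algebraMap A _ a) = G (algebraMap A _ a))
    (h₂ : ∀ v : M, F (ExteriorAlgebra.ι A v) = G (ExteriorAlgebra.ι A v)) : F = G := by
  ext x
  induction x using ExteriorAlgebra.induction with
  | algebraMap r => exact h₁ r
  | ι v => exact h₂ v
  | mul a b ha hb => rw [map_mul, map_mul, ha, hb]
  | add a b ha hb => rw [map_add, map_add, ha, hb]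

/-- Contraction is natural for semilinear maps. -/
theorem contractLeft_exteriorMap (σ : A →+* A) (f : M →ₛₗ[σ] M) (d : Module.Dual A M)
    (h : ∀ v, d (f v) = σ (d v)) (x : ExteriorAlgebra A M) :
    CliffordAlgebra.contractLeft (Q := (0 : QuadraticForm A M)) d (exteriorMap σ f x) =
      exteriorMap σ f (CliffordAlgebra.contractLeft (Q := (0 : QuadraticForm A M)) d x) := by
  induction x using CliffordAlgebra.left_induction with
  | algebraMap r =>
    have e := exteriorMap_algebraMap σ f r
    rw [CliffordAlgebra.contractLeft_algebraMap, map_zero]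
    refine (congrArg _ e).trans ?_
    exact CliffordAlgebra.contractLeft_algebraMap _ _ _
  | add a b ha hb => simp only [map_add, ha, hb]
  | ι_mul x v hx =>
    have e₁ : exteriorMap σ f (CliffordAlgebra.ι 0 v) = CliffordAlgebra.ι 0 (f v) :=
      exteriorMap_ι σ f v
    have e₂ : exteriorMap σ f (algebraMap A (CliffordAlgebra 0) (d v)) =
      algebraMap A (CliffordAlgebra 0) (σ (d v)) := exteriorMap_algebraMap σ f (d v)
    have e₃ : ∀ y z : CliffordAlgebra (0 : QuadraticForm A M), exteriorMap σ f (y * z) =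
      (exteriorMap σ f y : CliffordAlgebra (0 : QuadraticForm A M)) * exteriorMap σ f z :=
      fun y z => (exteriorMap σ f).map_mul y z
    rw [CliffordAlgebra.contractLeft_ι_mul, e₃, map_sub, e₃, Algebra.smul_def, e₃, e₁, e₂]
    refine (CliffordAlgebra.contractLeft_ι_mul _ _ _).trans ?_
    rw [hx, h, Algebra.smul_def]

end ExteriorSemilinear

/-- Constant-coefficient holomorphic differential operators `ℂ[∂₁, ∂₂]` on `ℂ²`. -/
abbrev DiffOp := MvPolynomial (Fin 2) ℂ

/-- Polynomial functions of the Taylor jet of `γ` at the origin: the variable `X n` is the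
linear operator `γ ↦ (∂₁ ^ n₁ ∂₂ ^ n₂ γ)(0)`. -/
abbrev GammaAlg := MvPolynomial (Fin 2 →₀ ℕ) ℂ

/-- The free `GammaAlg`-module on the linear operators `β ↦ (∂₁ ^ n₁ ∂₂ ^ n₂ β)(0)`. -/
abbrev BetaMod := (Fin 2 →₀ ℕ) →₀ GammaAlg

/-- Holomorphic local operators at the origin of the `βγ` system on `ℂ²` with values in `V = ℂ`:
polynomial in the (even) derivatives of `γ`, exterior in the (odd) derivatives of `β`, i.e.
`Sym (⊕ₙ ℂ γₙ) ⊗ Λ (⊕ₙ ℂ βₙ)`. -/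
abbrev Obs := ExteriorAlgebra GammaAlg BetaMod

/-- The linear operator `γ ↦ (D γ)(0)`. -/
noncomputable def gammaOp : DiffOp →ₗ[ℂ] GammaAlg :=
  (MvPolynomial.basisMonomials (Fin 2) ℂ).constr ℂ (fun n => MvPolynomial.X n)

/-- The linear operator `β ↦ (D β)(0)`. -/
noncomputable def betaOp : DiffOp →ₗ[ℂ] BetaMod :=
  (MvPolynomial.basisMonomials (Fin 2) ℂ).constr ℂ (fun n => Finsupp.single n 1)

/-- The generic formal field `γ(z) = ∑ₙ γₙ z₁ ^ n₁ z₂ ^ n₂ / (n₁! n₂!)`. -/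
noncomputable def genericField : MvPowerSeries (Fin 2) GammaAlg :=
  fun n => ((((n 0).factorial * (n 1).factorial : ℕ) : ℂ)⁻¹) • MvPolynomial.X n

/-- The composite operator `γ ↦ ∂₁ ^ n₁ ∂₂ ^ n₂ (F(γ(z)))` at `z = 0`. -/
noncomputable def jetOp (F : Polynomial ℂ) (n : Fin 2 →₀ ℕ) : GammaAlg :=
  (((n 0).factorial * (n 1).factorial : ℕ) : ℂ) •
    MvPowerSeries.coeff n (Polynomial.aeval genericField F)

/-- The interaction differential of the superpotential `W`: the `GammaAlg`-linear antiderivation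
with `βₙ ↦ ∂ⁿ (W'(γ(z)))` at `z = 0`. -/
noncomputable def sInt (W : Polynomial ℂ) : Obs →ₗ[ℂ] Obs :=
  (CliffordAlgebra.contractLeft (Q := (0 : QuadraticForm GammaAlg BetaMod))
    (Finsupp.linearCombination GammaAlg (jetOp (Polynomial.derivative W)))).restrictScalars ℂ

theorem sInt_sInt (W : Polynomial ℂ) (x : Obs) : sInt W (sInt W x) = 0 :=
  CliffordAlgebra.contractLeft_contractLeft (Q := (0 : QuadraticForm GammaAlg BetaMod)) _ x

/-- Operators of ghost number `i` modulo 2. -/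
noncomputable def obsParity (i : ZMod 2) : Submodule ℂ Obs :=
  (CliffordAlgebra.evenOdd (0 : QuadraticForm GammaAlg BetaMod) i).restrictScalars ℂ

/-- Linear change of coordinates on derivatives: `∂ⱼ ↦ ∑ᵢ gᵢⱼ ∂ᵢ`. -/
noncomputable def coordChange (g : Matrix (Fin 2) (Fin 2) ℂ) : DiffOp →ₐ[ℂ] DiffOp :=
  MvPolynomial.aeval (fun j => ∑ i, g i j • MvPolynomial.X i)

/-- `(D γ)(0) ↦ a • (g D γ)(0)`, extended multiplicatively. -/
noncomputable def gammaAct (g : Matrix (Fin 2) (Fin 2) ℂ) (a : ℂ) : GammaAlg →ₐ[ℂ] GammaAlg :=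
  MvPolynomial.aeval (fun n => a • gammaOp (coordChange g (MvPolynomial.monomial n 1)))

/-- `(D β)(0) ↦ b • (g D β)(0)`, extended semilinearly over the action on `γ`. -/
noncomputable def betaAct (g : Matrix (Fin 2) (Fin 2) ℂ) (a b : ℂ) :
    BetaMod →ₛₗ[(gammaAct g a : GammaAlg →+* GammaAlg)] BetaMod where
  toFun v := Finsupp.linearCombination GammaAlg
    (fun n => b • betaOp (coordChange g (MvPolynomial.monomial n 1)))
    (v.mapRange (gammaAct g a) (map_zero _))
  map_add' v w := by
    rw [Finsupp.mapRange_add (map_add _), map_add]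
  map_smul' c v := by
    have : (c • v).mapRange (gammaAct g a) (map_zero _) =
        gammaAct g a c • v.mapRange (gammaAct g a) (map_zero _) := by
      ext1 n; simp
    rw [this, map_smul]; rfl

theorem gammaOp_monomial (n : Fin 2 →₀ ℕ) :
    gammaOp (MvPolynomial.monomial n 1) = MvPolynomial.X n := by
  have := (MvPolynomial.basisMonomials (Fin 2) ℂ).constr_basis ℂ
    (fun n => (MvPolynomial.X n : GammaAlg)) n
  rwa [MvPolynomial.coe_basisMonomials] at this

theorem betaOp_monomial (n : Fin 2 →₀ ℕ) :
    betaOp (MvPolynomial.monomial n 1) = Finsupp.single n 1 := by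
  have := (MvPolynomial.basisMonomials (Fin 2) ℂ).constr_basis ℂ
    (fun n => (Finsupp.single n 1 : BetaMod)) n
  rwa [MvPolynomial.coe_basisMonomials] at this

theorem diffOp_hom_ext {E : Type*} [AddCommGroup E] [Module ℂ E] {f g : DiffOp →ₗ[ℂ] E}
    (h : ∀ n, f (MvPolynomial.monomial n 1) = g (MvPolynomial.monomial n 1)) : f = g :=
  (MvPolynomial.basisMonomials (Fin 2) ℂ).ext (by simpa using h)

theorem coordChange_one : coordChange 1 = AlgHom.id ℂ DiffOp := by
  ext1 j
  fin_cases j <;> simp [coordChange, Matrix.one_apply]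

theorem coordChange_mul (g h : Matrix (Fin 2) (Fin 2) ℂ) :
    coordChange (g * h) = (coordChange g).comp (coordChange h) := by
  ext1 j
  simp only [coordChange, MvPolynomial.aeval_X, AlgHom.comp_apply, Fin.sum_univ_two, map_add,
    map_smul, Matrix.mul_apply, smul_add, smul_smul, add_smul]
  simp only [mul_comm (h _ _)]
  abel

theorem gammaAct_gammaOp (g : Matrix (Fin 2) (Fin 2) ℂ) (a : ℂ) (D : DiffOp) :
    gammaAct g a (gammaOp D) = a • gammaOp (coordChange g D) := by
  have : (gammaAct g a).toLinearMap ∘ₗ gammaOp = a • (gammaOp ∘ₗ (coordChange g).toLinearMap) := by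
    apply diffOp_hom_ext
    intro n
    simp [gammaOp_monomial, gammaAct]
  exact LinearMap.congr_fun this D

theorem betaAct_smul (g : Matrix (Fin 2) (Fin 2) ℂ) (a b t : ℂ) (w : BetaMod) :
    betaAct g a b (t • w) = t • betaAct g a b w := by
  rw [← algebraMap_smul GammaAlg t w, map_smulₛₗ,
    show (gammaAct g a : GammaAlg →+* GammaAlg) (algebraMap ℂ GammaAlg t) =
      algebraMap ℂ GammaAlg t from (gammaAct g a).commutes t, algebraMap_smul]

theorem betaAct_single (g : Matrix (Fin 2) (Fin 2) ℂ) (a b : ℂ) (n : Fin 2 →₀ ℕ) :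
    betaAct g a b (Finsupp.single n 1) =
      b • betaOp (coordChange g (MvPolynomial.monomial n 1)) := by
  have : betaAct g a b (Finsupp.single n 1) = Finsupp.linearCombination GammaAlg
    (fun n => b • betaOp (coordChange g (MvPolynomial.monomial n 1)))
    ((Finsupp.single n 1).mapRange (gammaAct g a) (map_zero _)) := rfl
  rw [this, Finsupp.mapRange_single, Finsupp.linearCombination_single, map_one, one_smul]

theorem betaAct_betaOp (g : Matrix (Fin 2) (Fin 2) ℂ) (a b : ℂ) (D : DiffOp) :
    betaAct g a b (betaOp D) = b • betaOp (coordChange g D) := by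
  induction D using MvPolynomial.induction_on' with
  | monomial n c =>
    have e : MvPolynomial.monomial n c = c • (MvPolynomial.monomial n 1 : DiffOp) := by
      rw [MvPolynomial.smul_monomial, smul_eq_mul, mul_one]
    rw [e, map_smul, betaAct_smul, map_smul, map_smul, smul_comm b, betaOp_monomial]
    rw [betaAct_single]
  | add p q hp hq => simp only [map_add, hp, hq, smul_add]

theorem gammaAct_one : gammaAct 1 1 = AlgHom.id ℂ GammaAlg := by
  ext1 n
  simp [gammaAct, coordChange_one, gammaOp_monomial]

theorem gammaAct_mul (g h : Matrix (Fin 2) (Fin 2) ℂ) (a b : ℂ) :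
    gammaAct (g * h) (a * b) = (gammaAct g a).comp (gammaAct h b) := by
  ext1 n
  rw [AlgHom.comp_apply, ← gammaOp_monomial, gammaAct_gammaOp, gammaAct_gammaOp, map_smul,
    gammaAct_gammaOp, coordChange_mul, smul_smul, AlgHom.comp_apply, mul_comm]

theorem betaMod_induction {p : BetaMod → Prop} (h₀ : p 0) (h₁ : ∀ v w, p v → p w → p (v + w))
    (h₂ : ∀ (c : GammaAlg) n, p (c • betaOp (MvPolynomial.monomial n 1))) (v : BetaMod) : p v := by
  induction v using Finsupp.induction_linear with
  | zero => exact h₀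
  | add v w hv hw => exact h₁ v w hv hw
  | single n c =>
    have := h₂ c n
    rwa [betaOp_monomial, Finsupp.smul_single, smul_eq_mul, mul_one] at this

theorem betaAct_one (v : BetaMod) : betaAct 1 1 1 v = v := by
  induction v using betaMod_induction with
  | h₀ => simp
  | h₁ v w hv hw => rw [map_add, hv, hw]
  | h₂ c n =>
    rw [map_smulₛₗ, betaAct_betaOp, coordChange_one, gammaAct_one]; simp

theorem betaAct_mul (g h : Matrix (Fin 2) (Fin 2) ℂ) (a b a' b' : ℂ) (v : BetaMod) :
    betaAct (g * h) (a * a') (b * b') v = betaAct g a b (betaAct h a' b' v) := by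
  induction v using betaMod_induction with
  | h₀ => simp
  | h₁ v w hv hw => simp only [map_add, hv, hw]
  | h₂ c n =>
    rw [map_smulₛₗ, map_smulₛₗ, map_smulₛₗ, betaAct_betaOp, betaAct_betaOp, betaAct_smul, betaAct_betaOp,
      coordChange_mul, gammaAct_mul, smul_smul, AlgHom.comp_apply, mul_comm b b']
    rfl

/-- The action on all operators induced by a linear change of coordinates `g` on derivatives and
by scalings `a` of `γ` and `b` of `β`. -/
noncomputable def obsAct (g : Matrix (Fin 2) (Fin 2) ℂ) (a b : ℂ) : Obs →+* Obs :=
  exteriorMap (gammaAct g a : GammaAlg →+* GammaAlg) (betaAct g a b)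

theorem obsAct_one : obsAct 1 1 1 = RingHom.id Obs := by
  apply exterior_ringHom_ext
  · intro c
    rw [obsAct, exteriorMap_algebraMap, gammaAct_one]; rfl
  · intro v
    rw [obsAct, exteriorMap_ι, betaAct_one]; rfl

theorem obsAct_mul (g h : Matrix (Fin 2) (Fin 2) ℂ) (a b a' b' : ℂ) :
    obsAct (g * h) (a * a') (b * b') = (obsAct g a b).comp (obsAct h a' b') := by
  apply exterior_ringHom_ext
  · intro c
    rw [RingHom.comp_apply, obsAct, obsAct, obsAct, exteriorMap_algebraMap,
      exteriorMap_algebraMap, exteriorMap_algebraMap, gammaAct_mul]; rfl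
  · intro v
    rw [RingHom.comp_apply, obsAct, obsAct, obsAct, exteriorMap_ι, exteriorMap_ι, exteriorMap_ι,
      betaAct_mul]

theorem obsAct_smul (g : Matrix (Fin 2) (Fin 2) ℂ) (a b t : ℂ) (x : Obs) :
    obsAct g a b (t • x) = t • obsAct g a b x := by
  rw [← algebraMap_smul GammaAlg t x, Algebra.smul_def, map_mul, obsAct, exteriorMap_algebraMap,
    show (gammaAct g a : GammaAlg →+* GammaAlg) (algebraMap ℂ GammaAlg t) =
          algebraMap ℂ GammaAlg t from (gammaAct g a).commutes t, ← Algebra.smul_def,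
    algebraMap_smul]


/-- The total derivative `∂ᵢ` on polynomials in the jet of `γ`. -/
noncomputable def totalDeriv (i : Fin 2) : Derivation ℂ GammaAlg GammaAlg :=
  MvPolynomial.mkDerivation ℂ (fun n => MvPolynomial.X (n + Finsupp.single i 1))

theorem totalDeriv_X (i : Fin 2) (n : Fin 2 →₀ ℕ) :
    totalDeriv i (MvPolynomial.X n) = MvPolynomial.X (n + Finsupp.single i 1) :=
  MvPolynomial.mkDerivation_X _ _ _

theorem totalDeriv_smul (i : Fin 2) (c : ℂ) (p : GammaAlg) :
    totalDeriv i (c • p) = c • totalDeriv i p :=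
  Derivation.map_smul (totalDeriv i) c p

theorem coordChange_X (g : Matrix (Fin 2) (Fin 2) ℂ) (j : Fin 2) :
    coordChange g (MvPolynomial.X j) = ∑ i, g i j • MvPolynomial.X i :=
  MvPolynomial.aeval_X _ _

theorem coeff_genericField (n : Fin 2 →₀ ℕ) : MvPowerSeries.coeff n genericField =
    ((((n 0).factorial * (n 1).factorial : ℕ) : ℂ)⁻¹) • MvPolynomial.X n := rfl

theorem natCast_add_one_eq_C (k : ℕ) :
    ((k : GammaAlg) + 1) = MvPolynomial.C ((k : ℂ) + 1) := by simp

theorem totalDeriv_gammaOp (i : Fin 2) (D : DiffOp) :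
    totalDeriv i (gammaOp D) = gammaOp (MvPolynomial.X i * D) := by
  have : (totalDeriv i : GammaAlg →ₗ[ℂ] GammaAlg) ∘ₗ gammaOp =
      gammaOp ∘ₗ LinearMap.mulLeft ℂ (MvPolynomial.X i) := by
    apply diffOp_hom_ext
    intro n
    have e : (MvPolynomial.X i * MvPolynomial.monomial n 1 : DiffOp) =
        MvPolynomial.monomial (n + Finsupp.single i 1) 1 := by
      rw [MvPolynomial.X, MvPolynomial.monomial_mul, one_mul, add_comm]
    simp only [LinearMap.comp_apply, LinearMap.mulLeft_apply, e, gammaOp_monomial]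
    exact MvPolynomial.mkDerivation_X _ _ _
  exact LinearMap.congr_fun this D

theorem gammaAct_totalDeriv (g : Matrix (Fin 2) (Fin 2) ℂ) (a : ℂ) (j : Fin 2) (p : GammaAlg) :
    gammaAct g a (totalDeriv j p) = ∑ i, g i j • totalDeriv i (gammaAct g a p) := by
  induction p using MvPolynomial.induction_on with
  | C c =>
    have : gammaAct g a (MvPolynomial.C c) = MvPolynomial.C c := (gammaAct g a).commutes c
    simp [this]
  | add p q hp hq => simp only [map_add, hp, hq, smul_add, Finset.sum_add_distrib]
  | mul_X p n hp =>
    have hX : gammaAct g a (totalDeriv j (MvPolynomial.X n)) =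
        ∑ i, g i j • totalDeriv i (gammaAct g a (MvPolynomial.X n)) := by
      rw [← gammaOp_monomial, totalDeriv_gammaOp, gammaAct_gammaOp, gammaAct_gammaOp, map_mul]
      simp only [totalDeriv_smul, totalDeriv_gammaOp, coordChange_X, Fin.sum_univ_two, add_mul,
        map_add, smul_mul_assoc, map_smul, smul_add, smul_comm _ a]
    simp only [Derivation.leibniz, map_add, map_mul, smul_eq_mul, hp, hX, Fin.sum_univ_two,
      smul_add, mul_add, mul_smul_comm]
    abel

/-- Formal series in `z` whose `z`-derivatives are the total derivatives of the coefficients. -/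
def IsJet (F : MvPowerSeries (Fin 2) GammaAlg) : Prop :=
  ∀ n i, totalDeriv i (MvPowerSeries.coeff n F) =
    MvPowerSeries.coeff n (MvPowerSeries.pderiv GammaAlg i F)

theorem isJet_mul {F G : MvPowerSeries (Fin 2) GammaAlg} (hF : IsJet F) (hG : IsJet G) :
    IsJet (F * G) := by
  classical
  intro n i
  rw [Derivation.leibniz, MvPowerSeries.coeff_mul, map_sum, map_add, smul_eq_mul, smul_eq_mul,
    mul_comm G, MvPowerSeries.coeff_mul, MvPowerSeries.coeff_mul, ← Finset.sum_add_distrib]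
  refine Finset.sum_congr rfl fun x _ => ?_
  rw [Derivation.leibniz, hF, hG, smul_eq_mul, smul_eq_mul, mul_comm (MvPowerSeries.coeff x.2 G)]

theorem isJet_genericField : IsJet genericField := by
  intro n i
  rw [MvPowerSeries.coeff_pderiv, coeff_genericField, coeff_genericField, totalDeriv_smul,
    totalDeriv_X, natCast_add_one_eq_C, mul_comm (_ • _), ← MvPolynomial.smul_eq_C_mul, smul_smul]
  refine congrArg (fun c : ℂ => c • (MvPolynomial.X (n + Finsupp.single i 1) : GammaAlg)) ?_
  have h0 : ∀ k : ℕ, (k.factorial : ℂ) ≠ 0 := fun k => by exact_mod_cast k.factorial_ne_zero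
  have h1 : ∀ k : ℕ, (k : ℂ) + 1 ≠ 0 := fun k => by exact_mod_cast k.succ_ne_zero
  have := h0 (n 0)
  have := h0 (n 1)
  have := h1 (n 0)
  have := h1 (n 1)
  fin_cases i
  · simp [Nat.factorial_succ]
    field_simp
  · simp [Nat.factorial_succ]
    field_simp

theorem isJet_pow (k : ℕ) : IsJet (genericField ^ k) := by
  induction k with
  | zero =>
    classical
    intro n i
    rw [pow_zero, MvPowerSeries.pderiv_one, MvPowerSeries.coeff_one]
    split_ifs <;> simp
  | succ k ih => rw [pow_succ]; exact isJet_mul ih isJet_genericField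

/-- `D ↦ (D F)(0)`, for a formal series `F` in `z`. -/
noncomputable def jetPair (F : MvPowerSeries (Fin 2) GammaAlg) : DiffOp →ₗ[ℂ] GammaAlg :=
  (MvPolynomial.basisMonomials (Fin 2) ℂ).constr ℂ (fun n =>
    (((n 0).factorial * (n 1).factorial : ℕ) : ℂ) • MvPowerSeries.coeff n F)

theorem jetPair_monomial (F : MvPowerSeries (Fin 2) GammaAlg) (n : Fin 2 →₀ ℕ) :
    jetPair F (MvPolynomial.monomial n 1) =
      (((n 0).factorial * (n 1).factorial : ℕ) : ℂ) • MvPowerSeries.coeff n F := by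
  have := (MvPolynomial.basisMonomials (Fin 2) ℂ).constr_basis ℂ
    (fun n => (((n 0).factorial * (n 1).factorial : ℕ) : ℂ) • MvPowerSeries.coeff n F) n
  rwa [MvPolynomial.coe_basisMonomials] at this

theorem jetPair_X_mul {F : MvPowerSeries (Fin 2) GammaAlg} (hF : IsJet F) (i : Fin 2)
    (D : DiffOp) : jetPair F (MvPolynomial.X i * D) = totalDeriv i (jetPair F D) := by
  have : jetPair F ∘ₗ LinearMap.mulLeft ℂ (MvPolynomial.X i) =
      (totalDeriv i : GammaAlg →ₗ[ℂ] GammaAlg) ∘ₗ jetPair F := by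
    apply diffOp_hom_ext
    intro n
    have e : (MvPolynomial.X i * MvPolynomial.monomial n 1 : DiffOp) =
        MvPolynomial.monomial (n + Finsupp.single i 1) 1 := by
      rw [MvPolynomial.X, MvPolynomial.monomial_mul, one_mul, add_comm]
    simp only [LinearMap.comp_apply, LinearMap.mulLeft_apply, e, jetPair_monomial]
    change _ = totalDeriv i _
    rw [totalDeriv_smul, hF, MvPowerSeries.coeff_pderiv, natCast_add_one_eq_C,
      mul_comm (MvPowerSeries.coeff _ F), ← MvPolynomial.smul_eq_C_mul, smul_smul]
    refine congrArg (fun c : ℂ => c • MvPowerSeries.coeff (n + Finsupp.single i 1) F) ?_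
    fin_cases i
    · simp [Nat.factorial_succ]; ring
    · simp [Nat.factorial_succ]; ring
  exact LinearMap.congr_fun this D

theorem gammaAct_jetPair (g : Matrix (Fin 2) (Fin 2) ℂ) (a : ℂ) (k : ℕ) (D : DiffOp) :
    gammaAct g a (jetPair (genericField ^ k) D) =
      a ^ k • jetPair (genericField ^ k) (coordChange g D) := by
  induction D using MvPolynomial.induction_on with
  | C c =>
    have e : ∀ c : ℂ, (MvPolynomial.C c : DiffOp) = c • MvPolynomial.monomial 0 1 := by
      intro c; rw [MvPolynomial.smul_monomial, smul_eq_mul, mul_one]; rfl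
    have e₁ : coordChange g (MvPolynomial.C c) = MvPolynomial.C c := (coordChange g).commutes c
    have e₂ : MvPowerSeries.constantCoeff genericField = MvPolynomial.X 0 := by
      rw [← MvPowerSeries.coeff_zero_eq_constantCoeff_apply, coeff_genericField]
      simp
    have e₄ : MvPowerSeries.coeff 0 (genericField ^ k) = MvPolynomial.X 0 ^ k := by
      rw [MvPowerSeries.coeff_zero_eq_constantCoeff_apply, map_pow, e₂]
    have e₃ : gammaAct g a (MvPolynomial.X 0) = a • MvPolynomial.X 0 := by
      rw [← gammaOp_monomial, gammaAct_gammaOp]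
      congr 2
      exact map_one (coordChange g)
    rw [e₁, e, map_smul, map_smul, jetPair_monomial, e₄, map_smul, map_pow, e₃, smul_pow]
    module
  | add p q hp hq => simp only [map_add, hp, hq, smul_add]
  | mul_X D j hD =>
    rw [mul_comm, jetPair_X_mul (isJet_pow k), gammaAct_totalDeriv, hD, map_mul]
    simp only [coordChange_X, Fin.sum_univ_two, add_mul, map_add, smul_mul_assoc, map_smul,
      totalDeriv_smul, jetPair_X_mul (isJet_pow k), smul_add, smul_comm _ (a ^ k)]

/-- `W` is homogeneous of degree `d` as a function on `V = ℂ`. -/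
def IsHomogeneous (W : Polynomial ℂ) (d : ℕ) : Prop :=
  ∀ t x : ℂ, W.eval (t * x) = t ^ d * W.eval x

theorem IsHomogeneous.eq_monomial {W : Polynomial ℂ} {d : ℕ} (hW : IsHomogeneous W d) :
    W = Polynomial.monomial d (W.coeff d) := by
  have h : W.comp (Polynomial.C 2 * Polynomial.X) = Polynomial.C (2 ^ d) * W := by
    apply Polynomial.funext
    intro x
    simpa using hW 2 x
  ext k
  rw [Polynomial.coeff_monomial]
  split_ifs with hk
  · rw [hk]
  · have := congrArg (fun p => Polynomial.coeff p k) h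
    simp only [Polynomial.comp_C_mul_X_coeff, Polynomial.coeff_C_mul] at this
    have h2 : (2 : ℂ) ^ k ≠ 2 ^ d := by
      intro h
      have : (2 : ℕ) ^ k = 2 ^ d := by exact_mod_cast h
      exact hk (Nat.pow_right_injective le_rfl this).symm
    have h3 : W.coeff k * ((2 : ℂ) ^ k - 2 ^ d) = 0 := by linear_combination this
    rcases mul_eq_zero.mp h3 with h | h
    · exact h
    · exact absurd (sub_eq_zero.mp h) h2

theorem jetOp_eq_jetPair {W : Polynomial ℂ} {N : ℕ} (hW : IsHomogeneous W (N + 1))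
    (n : Fin 2 →₀ ℕ) :
    jetOp (Polynomial.derivative W) n = (W.coeff (N + 1) * ((N : ℂ) + 1)) •
      jetPair (genericField ^ N) (MvPolynomial.monomial n 1) := by
  have h := hW.eq_monomial
  set c := W.coeff (N + 1)
  rw [h, Polynomial.derivative_monomial, jetPair_monomial, jetOp, Polynomial.aeval_monomial,
    smul_comm, ← Algebra.smul_def]
  simp only [Nat.cast_add, Nat.cast_one, Nat.add_sub_cancel]
  rfl

/-- A symmetry of the free theory commutes with the interaction differential of a homogeneous
superpotential as soon as it scales `β` by the `N`-th power of its scaling of `γ`. -/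
theorem sInt_obsAct {W : Polynomial ℂ} {N : ℕ} (hW : IsHomogeneous W (N + 1))
    (g : Matrix (Fin 2) (Fin 2) ℂ) (a : ℂ) (x : Obs) :
    sInt W (obsAct g a (a ^ N) x) = obsAct g a (a ^ N) (sInt W x) := by
  refine contractLeft_exteriorMap (gammaAct g a : GammaAlg →+* GammaAlg) (betaAct g a (a ^ N))
    (Finsupp.linearCombination GammaAlg (jetOp (Polynomial.derivative W))) ?_ x
  have key : ∀ D : DiffOp, Finsupp.linearCombination GammaAlg (jetOp (Polynomial.derivative W))
      (betaOp D) = (W.coeff (N + 1) * ((N : ℂ) + 1)) • jetPair (genericField ^ N) D := by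
    intro D
    have : ((Finsupp.linearCombination GammaAlg
        (jetOp (Polynomial.derivative W))).restrictScalars ℂ) ∘ₗ betaOp =
        (W.coeff (N + 1) * ((N : ℂ) + 1)) • jetPair (genericField ^ N) := by
      apply diffOp_hom_ext
      intro n
      simp [betaOp_monomial, jetOp_eq_jetPair hW]
    exact LinearMap.congr_fun this D
  intro v
  induction v using betaMod_induction with
  | h₀ => simp
  | h₁ v w hv hw => simp only [map_add, hv, hw]
  | h₂ c n =>
    rw [map_smulₛₗ, map_smul, map_smul, smul_eq_mul, smul_eq_mul, map_mul, betaAct_betaOp]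
    congr 1
    rw [key, ← algebraMap_smul GammaAlg (a ^ N), map_smul, algebraMap_smul, key]
    change _ = gammaAct g a _
    rw [map_smul, gammaAct_jetPair, smul_comm]

/-- Cohomology of the complex of holomorphic local operators with interaction `W`. -/
abbrev Cohomology (W : Polynomial ℂ) : Type :=
  LinearMap.ker (sInt W) ⧸ (LinearMap.range (sInt W)).comap (LinearMap.ker (sInt W)).subtype

/-- Classes represented by cocycles of ghost number `i` modulo 2. -/
noncomputable def cohomologyParity (W : Polynomial ℂ) (i : ZMod 2) :
    Submodule ℂ (Cohomology W) :=
  ((obsParity i).comap (LinearMap.ker (sInt W)).subtype).map (Submodule.mkQ _)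

/-- The symmetry group `SU(2) × U(1)_q × U(1)_z × U(1)_u` of the free theory. -/
abbrev FreeSymmetry : Type :=
  Matrix.specialUnitaryGroup (Fin 2) ℂ × Circle × Circle × Circle

/-- The symmetry group `SU(2) × U(1)_q × U(1)_z` of the theory with superpotential. -/
abbrev Symmetry : Type := Matrix.specialUnitaryGroup (Fin 2) ℂ × Circle × Circle

/-- The action of the free symmetry group on operators. `SU(2)` acts on derivatives through the
fundamental representation, each derivative has `q`-weight `1`, `γ` has weights
`(q, z, u) = (0, 1, 0)`, and `β`, which is the coefficient of `d²z`, has weights `(2, -1, 1)`. -/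
noncomputable def freeRep : Representation ℂ FreeSymmetry Obs where
  toFun s :=
    { toFun := obsAct ((s.2.1 : ℂ) • (s.1 : Matrix (Fin 2) (Fin 2) ℂ)) (s.2.2.1 : ℂ)
        ((s.2.1 : ℂ) ^ 2 * (s.2.2.1 : ℂ)⁻¹ * (s.2.2.2 : ℂ))
      map_add' := map_add _
      map_smul' := obsAct_smul _ _ _ }
  map_one' := by
    refine LinearMap.ext fun x => ?_
    refine Eq.trans ?_ (RingHom.congr_fun obsAct_one x)
    change obsAct _ _ _ x = _
    congr 2 <;> simp
  map_mul' s t := by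
    refine LinearMap.ext fun x => ?_
    refine Eq.trans ?_ (RingHom.congr_fun (obsAct_mul _ _ _ _ _ _) x)
    change obsAct _ _ _ x = _
    congr 2
    · simp only [Prod.fst_mul, Prod.snd_mul, Circle.coe_mul, Submonoid.coe_mul, smul_mul_smul_comm]
    · simp only [Prod.fst_mul, Prod.snd_mul, Circle.coe_mul, mul_inv, mul_pow]
      ring

/-- The subgroup of free symmetries preserved by a superpotential of degree `N + 1`:
`u = q⁻² z ^ (N + 1)`. -/
noncomputable def survivingSymmetry (N : ℕ) : Symmetry →* FreeSymmetry where
  toFun s := (s.1, s.2.1, s.2.2, (s.2.1 ^ 2)⁻¹ * s.2.2 ^ (N + 1))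
  map_one' := by simp
  map_mul' s t := by
    simp only [Prod.fst_mul, Prod.snd_mul, mul_pow, mul_inv, Prod.mk_mul_mk]
    rw [mul_mul_mul_comm]

/-- The action of `SU(2) × U(1)_q × U(1)_z` on holomorphic local operators. -/
noncomputable def obsRep (N : ℕ) : Representation ℂ Symmetry Obs :=
  MonoidHom.comp freeRep (survivingSymmetry N)

theorem sInt_obsRep {W : Polynomial ℂ} {N : ℕ} (hW : IsHomogeneous W (N + 1)) (s : Symmetry)
    (x : Obs) : sInt W (obsRep N s x) = obsRep N s (sInt W x) := by
  have e : ((s.2.1 : ℂ) ^ 2 * (s.2.2 : ℂ)⁻¹ * (((s.2.1 ^ 2)⁻¹ * s.2.2 ^ (N + 1) : Circle) : ℂ)) =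
      (s.2.2 : ℂ) ^ N := by
    have h₁ := s.2.1.coe_ne_zero
    have h₂ := s.2.2.coe_ne_zero
    simp only [Circle.coe_mul, Circle.coe_inv, Circle.coe_pow]
    field_simp
    ring
  have h := sInt_obsAct hW ((s.2.1 : ℂ) • (s.1 : Matrix (Fin 2) (Fin 2) ℂ)) (s.2.2 : ℂ) x
  rw [← e] at h
  exact h

/-- The induced action of `SU(2) × U(1)_q × U(1)_z` on cohomology. -/
noncomputable def cohomologyRep (W : Polynomial ℂ) (N : ℕ) (hW : IsHomogeneous W (N + 1)) :
    Representation ℂ Symmetry (Cohomology W) where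
  toFun s := Submodule.mapQ _ _
    ((obsRep N s).restrict (p := LinearMap.ker (sInt W)) (q := LinearMap.ker (sInt W))
      (fun x hx => by
        rw [LinearMap.mem_ker] at hx ⊢
        rw [sInt_obsRep hW, hx, map_zero]))
    (by
      rintro x ⟨y, hy⟩
      exact ⟨obsRep N s y, by rw [sInt_obsRep hW, hy]; rfl⟩)
  map_one' := by
    ext x
    have : obsRep N 1 x.1 = x.1 := by rw [map_one]; rfl
    exact congrArg (Submodule.Quotient.mk) (Subtype.ext this)
  map_mul' s t := by
    ext x
    have : obsRep N (s * t) x.1 = obsRep N s (obsRep N t x.1) := by rw [map_mul]; rfl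
    exact congrArg (Submodule.Quotient.mk) (Subtype.ext this)

/-- The element `diag(p, p⁻¹)` of `SU(2)`. -/
noncomputable def cartan (p : Circle) : Matrix.specialUnitaryGroup (Fin 2) ℂ :=
  ⟨Matrix.diagonal ![(p : ℂ), ((p⁻¹ : Circle) : ℂ)], by
    have hp : (p : ℂ) ≠ 0 := p.coe_ne_zero
    rw [Matrix.mem_specialUnitaryGroup_iff, Matrix.mem_unitaryGroup_iff]
    refine ⟨?_, ?_⟩
    · rw [Matrix.star_eq_conjTranspose, Matrix.diagonal_conjTranspose, Matrix.diagonal_mul_diagonal,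
        ← Matrix.diagonal_one]
      congr 1
      funext i
      fin_cases i <;> simp [← Circle.coe_inv_eq_conj, hp]
    · simp [Matrix.det_diagonal, hp]⟩

section Character

variable {E : Type*} [AddCommGroup E] [Module ℂ E]

/-- The subspace on which the maximal torus acts by the character `p ^ j q ^ m z ^ k`. -/
def weightSpace (ρ : Representation ℂ Symmetry E) (j m k : ℤ) : Submodule ℂ E where
  carrier := {v | ∀ p q z : Circle,
    ρ (cartan p, q, z) v = ((p ^ j * q ^ m * z ^ k : Circle) : ℂ) • v}
  add_mem' hv hw p q z := by rw [map_add, hv, hw, smul_add]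
  zero_mem' p q z := by rw [map_zero, smul_zero]
  smul_mem' c v hv p q z := by rw [map_smul, hv, smul_comm]

/-- `χ` is the character of the `ℤ/2`-graded representation `E = P 0 ⊕ P 1`: `E` is spanned by
weight vectors, each weight occurs with finite multiplicity, no weight has a negative exponent of
`q` or `z`, and the coefficient of `p ^ j q ^ m z ^ k` in `χ` is the superdimension of the
corresponding weight space. The variables are `q = X 0`, `z = X 1`, and `p = T`. -/
structure HasCharacter (ρ : Representation ℂ Symmetry E) (P : ZMod 2 → Submodule ℂ E)
    (χ : MvPowerSeries (Fin 2) ℤ[T;T⁻¹]) : Prop where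
  isCompl : IsCompl (P 0) (P 1)
  invariant : ∀ s i, P i ≤ (P i).comap (ρ s)
  iSup_weightSpace : ⨆ w : ℤ × ℤ × ℤ, weightSpace ρ w.1 w.2.1 w.2.2 = ⊤
  finite : ∀ j m k, FiniteDimensional ℂ (weightSpace ρ j m k)
  eq_bot : ∀ j m k, m < 0 ∨ k < 0 → weightSpace ρ j m k = ⊥
  coeff_eq : ∀ (j : ℤ) (m k : ℕ),
    (MvPowerSeries.coeff (Finsupp.single 0 m + Finsupp.single 1 k) χ).coeff j =
      (Module.finrank ℂ (weightSpace ρ j m k ⊓ P 0 : Submodule ℂ E) : ℤ) -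
        Module.finrank ℂ (weightSpace ρ j m k ⊓ P 1 : Submodule ℂ E)

end Character

/-- The coefficients `ℤ[p, p⁻¹]` of formal characters are discrete. -/
instance : TopologicalSpace ℤ[T;T⁻¹] := ⊥

instance : DiscreteTopology ℤ[T;T⁻¹] := ⟨rfl⟩

/-- The monomial `z ^ k q ^ m p ^ j`. -/
noncomputable def fugacity (k m : ℕ) (j : ℤ) : MvPowerSeries (Fin 2) ℤ[T;T⁻¹] :=
  MvPowerSeries.monomial (Finsupp.single 0 m + Finsupp.single 1 k) (LaurentPolynomial.T j)

/-- The factor `(1 - z ^ N q ^ m p ^ (2ℓ - m)) / (1 - z q ^ m p ^ (2ℓ - m))`. -/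
noncomputable def characterFactor (N : ℕ) (x : Σ m : ℕ, Fin (m + 1)) :
    MvPowerSeries (Fin 2) ℤ[T;T⁻¹] :=
  (1 - fugacity N x.1 (2 * (x.2 : ℤ) - x.1)) *
    MvPowerSeries.invOfUnit (1 - fugacity 1 x.1 (2 * (x.2 : ℤ) - x.1)) 1

end HolomorphicTwist

/-! The character of `Obs` is a count of monomials. Over `ℂ`, `Obs` has a basis of products of
powers of the `γₙ` with products of distinct `βₙ`; each is a torus weight vector whose parity is
that of its number of `β` factors (`exists_obs_basis`). Only finitely many of them share given
exponents of `q` and `z`: the `q`-exponent bounds the order of the derivatives that occur, the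
`z`-exponent bounds the powers of the `γₙ`, and no `βₙ` occurs twice, so `N = 0` is no exception.
The signed count by weight is therefore a well-defined formal series, and by `HasCharacter.of_basis`
it is the character.

The count factors over derivatives: the powers of `γₙ` give a geometric series and the presence or
absence of `βₙ` gives `1 - z ^ N q ^ m p ^ j`. The product over a finite set of derivatives is
exactly the signed count of the monomials built from that set (`prod_jetFactor`). Each coefficient
sees only derivatives of bounded order, so the partial products stabilise coefficientwise
(`hasProd_jetFactor`).

For cohomology, the differential squares to zero, is odd and commutes with the torus, so each
finite-dimensional weight space is a `ℤ/2`-graded complex, and passing to cohomology preserves its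
Euler characteristic (`HasCharacter.cohomology`). Taking cohomology commutes with taking weight
spaces because weight projections commute with equivariant maps (`weightProj_map`). -/

namespace HolomorphicTwist

/-! ### Weight spaces of the maximal torus and their projections -/

section WeightSpaces

variable {E F : Type*} [AddCommGroup E] [Module ℂ E] [AddCommGroup F] [Module ℂ F]

/-- The character `p ^ j q ^ m z ^ k` of the maximal torus. -/
noncomputable def torusChar (w : ℤ × ℤ × ℤ) (t : Circle × Circle × Circle) : ℂ :=
  ((t.1 ^ w.1 * t.2.1 ^ w.2.1 * t.2.2 ^ w.2.2 : Circle) : ℂ)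

/-- If `j ≠ j'`, the point `exp(iπ / (j - j'))` has `(j - j')`-th power `-1`, which is not `1`. -/
theorem circle_zpow_left_injective {j j' : ℤ} (h : ∀ p : Circle, p ^ j = p ^ j') : j = j' := by
  by_contra hne
  have hne' : ((j - j' : ℤ) : ℝ) ≠ 0 := by exact_mod_cast sub_ne_zero.mpr hne
  have h1 : (Circle.exp (Real.pi / (j - j' : ℤ))) ^ (j - j') = 1 := by
    rw [zpow_sub, h, mul_inv_cancel]
  rw [← Circle.exp_zsmul, zsmul_eq_mul, mul_div_cancel₀ _ hne'] at h1
  have h2 := congrArg (Subtype.val) h1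
  simp at h2
  norm_num at h2

theorem torusChar_injective : Function.Injective torusChar := by
  rintro ⟨j, m, k⟩ ⟨j', m', k'⟩ h
  have h' : ∀ p q z : Circle, p ^ j * q ^ m * z ^ k = p ^ j' * q ^ m' * z ^ k' :=
    fun p q z => Subtype.ext (congrFun h (p, q, z))
  refine Prod.ext (circle_zpow_left_injective fun p => ?_)
    (Prod.ext (circle_zpow_left_injective fun p => ?_) (circle_zpow_left_injective fun p => ?_))
  · simpa using h' p 1 1
  · simpa using h' 1 p 1
  · simpa using h' 1 1 p

theorem mem_weightSpace_iff {ρ : Representation ℂ Symmetry E} {w : ℤ × ℤ × ℤ} {v : E} :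
    v ∈ weightSpace ρ w.1 w.2.1 w.2.2 ↔
      ∀ t : Circle × Circle × Circle, ρ (cartan t.1, t.2) v = torusChar w t • v :=
  ⟨fun h t => h t.1 t.2.1 t.2.2, fun h p q z => h (p, q, z)⟩

theorem cartan_mul (p q : Circle) : cartan (p * q) = cartan p * cartan q := by
  apply Subtype.ext
  change Matrix.diagonal _ = Matrix.diagonal _ * Matrix.diagonal _
  rw [Matrix.diagonal_mul_diagonal]
  congr 1
  funext i
  fin_cases i <;> simp [mul_comm]

/-- The torus acts by commuting operators, whose simultaneous generalized eigenspaces for different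
families of eigenvalues are independent. Weight spaces lie inside these, and distinct weights give
distinct families by `torusChar_injective`. -/
theorem iSupIndep_weightSpace (ρ : Representation ℂ Symmetry E) :
    iSupIndep fun w : ℤ × ℤ × ℤ => weightSpace ρ w.1 w.2.1 w.2.2 := by
  let f : Circle × Circle × Circle → Module.End ℂ E := fun t => ρ (cartan t.1, t.2)
  have hc : ∀ s t, Commute (f s) (f t) := by
    intro s t
    change ρ _ * ρ _ = ρ _ * ρ _
    rw [← map_mul, ← map_mul]
    congr 1
    refine Prod.ext ?_ (mul_comm _ _)
    change cartan _ * cartan _ = cartan _ * cartan _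
    rw [← cartan_mul, ← cartan_mul, mul_comm]
  have := (Module.End.independent_iInf_maxGenEigenspace_of_forall_mapsTo f
    (fun i j φ => Module.End.mapsTo_maxGenEigenspace_of_comm (hc j i) φ)).comp
      torusChar_injective
  refine this.mono fun w v hv => ?_
  rw [Function.comp_apply, Submodule.mem_iInf]
  intro t
  refine (Module.End.genEigenspace (f t) _).monotone (le_top (a := 1)) ?_
  rw [Module.End.mem_genEigenspace_one]
  exact mem_weightSpace_iff.mp hv t

/-- A representation spanned by weight vectors is the direct sum of its weight spaces. -/
noncomputable def weightEquiv {ρ : Representation ℂ Symmetry E}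
    (h : ⨆ w : ℤ × ℤ × ℤ, weightSpace ρ w.1 w.2.1 w.2.2 = ⊤) :
    (DirectSum (ℤ × ℤ × ℤ) fun w => weightSpace ρ w.1 w.2.1 w.2.2) ≃ₗ[ℂ] E :=
  LinearEquiv.ofBijective (DirectSum.coeLinearMap _)
    (DirectSum.isInternal_submodule_of_iSupIndep_of_iSup_eq_top (iSupIndep_weightSpace ρ) h)

theorem weightEquiv_lof {ρ : Representation ℂ Symmetry E}
    (h : ⨆ w : ℤ × ℤ × ℤ, weightSpace ρ w.1 w.2.1 w.2.2 = ⊤) (w : ℤ × ℤ × ℤ)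
    (x : weightSpace ρ w.1 w.2.1 w.2.2) :
    weightEquiv h (DirectSum.lof ℂ _
      (fun w : ℤ × ℤ × ℤ => weightSpace ρ w.1 w.2.1 w.2.2) w x) = x :=
  DirectSum.coeLinearMap_lof _ _ _

/-- The projection onto a weight space of a representation spanned by weight vectors. -/
noncomputable def weightProj {ρ : Representation ℂ Symmetry E}
    (h : ⨆ w : ℤ × ℤ × ℤ, weightSpace ρ w.1 w.2.1 w.2.2 = ⊤) (w : ℤ × ℤ × ℤ) : E →ₗ[ℂ] E :=
  (weightSpace ρ w.1 w.2.1 w.2.2).subtype ∘ₗ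
    DirectSum.component ℂ _ (fun w : ℤ × ℤ × ℤ => weightSpace ρ w.1 w.2.1 w.2.2) w ∘ₗ
    (weightEquiv h).symm.toLinearMap

variable {ρ : Representation ℂ Symmetry E} {ρ' : Representation ℂ Symmetry F}

theorem weightProj_mem (h : ⨆ w : ℤ × ℤ × ℤ, weightSpace ρ w.1 w.2.1 w.2.2 = ⊤)
    (w : ℤ × ℤ × ℤ) (x : E) : weightProj h w x ∈ weightSpace ρ w.1 w.2.1 w.2.2 :=
  Subtype.property _

theorem weightProj_of_mem (h : ⨆ w : ℤ × ℤ × ℤ, weightSpace ρ w.1 w.2.1 w.2.2 = ⊤)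
    {w w' : ℤ × ℤ × ℤ} {x : E} (hx : x ∈ weightSpace ρ w'.1 w'.2.1 w'.2.2) :
    weightProj h w x = if w' = w then x else 0 := by
  have e : (weightEquiv h).symm x = DirectSum.lof ℂ _
      (fun w : ℤ × ℤ × ℤ => weightSpace ρ w.1 w.2.1 w.2.2) w' ⟨x, hx⟩ := by
    rw [LinearEquiv.symm_apply_eq, weightEquiv_lof]
  rw [weightProj, LinearMap.comp_apply, LinearMap.comp_apply, LinearEquiv.coe_coe, e]
  split_ifs with hw
  · subst hw
    rw [DirectSum.component.lof_self]; rfl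
  · rw [DirectSum.component.of, dif_neg hw, map_zero]

theorem map_mem_weightSpace {φ : E →ₗ[ℂ] F} (hφ : ∀ s x, φ (ρ s x) = ρ' s (φ x))
    {j m k : ℤ} {x : E} (hx : x ∈ weightSpace ρ j m k) : φ x ∈ weightSpace ρ' j m k := by
  intro p q z
  rw [← hφ, hx, map_smul]

/-- It is enough to test weight vectors, which an equivariant map sends to vectors of the same
weight; both projections then keep or kill them together. -/
theorem weightProj_map (h : ⨆ w : ℤ × ℤ × ℤ, weightSpace ρ w.1 w.2.1 w.2.2 = ⊤)
    (h' : ⨆ w : ℤ × ℤ × ℤ, weightSpace ρ' w.1 w.2.1 w.2.2 = ⊤)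
    {φ : E →ₗ[ℂ] F} (hφ : ∀ s x, φ (ρ s x) = ρ' s (φ x)) (w : ℤ × ℤ × ℤ)
    (x : E) : φ (weightProj h w x) = weightProj h' w (φ x) := by
  classical
  have hx : x ∈ ⨆ w : ℤ × ℤ × ℤ, weightSpace ρ w.1 w.2.1 w.2.2 := h ▸ Submodule.mem_top
  induction hx using Submodule.iSup_induction' with
  | mem w' x hx =>
    rw [weightProj_of_mem h hx, weightProj_of_mem h' (map_mem_weightSpace hφ hx)]
    split_ifs <;> simp
  | zero => simp
  | add x y _ _ hx hy => simp only [map_add, hx, hy]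

/-- Used for the kernel of an equivariant map `ψ`. The weight components of an element of the kernel
are again killed by `ψ`, since projections commute with it, and so they lift along `φ`. -/
theorem iSup_weightSpace_of_injective
    (h' : ⨆ w : ℤ × ℤ × ℤ, weightSpace ρ' w.1 w.2.1 w.2.2 = ⊤)
    {φ : E →ₗ[ℂ] F} (hφ : ∀ s x, φ (ρ s x) = ρ' s (φ x))
    (hinj : Function.Injective φ) {G : Type*} [AddCommGroup G] [Module ℂ G]
    {ρ'' : Representation ℂ Symmetry G}
    (h'' : ⨆ w : ℤ × ℤ × ℤ, weightSpace ρ'' w.1 w.2.1 w.2.2 = ⊤)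
    {ψ : F →ₗ[ℂ] G} (hψ : ∀ s x, ψ (ρ' s x) = ρ'' s (ψ x))
    (hex : LinearMap.range φ = LinearMap.ker ψ) :
    ⨆ w : ℤ × ℤ × ℤ, weightSpace ρ w.1 w.2.1 w.2.2 = ⊤ := by
  classical
  rw [eq_top_iff]
  rintro x -
  have hx : φ x ∈ ⨆ w : ℤ × ℤ × ℤ, weightSpace ρ' w.1 w.2.1 w.2.2 := h' ▸ Submodule.mem_top
  rw [Submodule.mem_iSup_iff_exists_finsupp] at hx
  obtain ⟨f, hf, hsum⟩ := hx
  have hproj : ∀ w, weightProj h' w (φ x) = f w := by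
    intro w
    rw [← hsum, Finsupp.sum, map_sum]
    simp only [weightProj_of_mem h' (hf _)]
    rw [Finset.sum_ite_eq' f.support w]
    split_ifs with hw
    · rfl
    · rw [Finsupp.notMem_support_iff.mp hw]
  have hmem : ∀ w, ∃ y, φ y = f w := by
    intro w
    have : f w ∈ LinearMap.ker ψ := by
      rw [LinearMap.mem_ker, ← hproj, weightProj_map h' h'' hψ]
      have : φ x ∈ LinearMap.ker ψ := hex ▸ ⟨x, rfl⟩
      rw [LinearMap.mem_ker.mp this, map_zero]
    rwa [← hex] at this
  choose y hy using hmem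
  have hxy : x = ∑ w ∈ f.support, y w := by
    apply hinj
    rw [map_sum, ← hsum, Finsupp.sum]
    exact Finset.sum_congr rfl fun w _ => (hy w).symm
  rw [hxy]
  refine Submodule.sum_mem _ fun w _ => Submodule.mem_iSup_of_mem w ?_
  intro p q z
  apply hinj
  rw [hφ, map_smul, hy, hf]

theorem iSup_weightSpace_of_surjective
    (h : ⨆ w : ℤ × ℤ × ℤ, weightSpace ρ w.1 w.2.1 w.2.2 = ⊤)
    {φ : E →ₗ[ℂ] F} (hφ : ∀ s x, φ (ρ s x) = ρ' s (φ x))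
    (hsurj : Function.Surjective φ) :
    ⨆ w : ℤ × ℤ × ℤ, weightSpace ρ' w.1 w.2.1 w.2.2 = ⊤ := by
  rw [eq_top_iff, ← LinearMap.range_eq_top.mpr hsurj, LinearMap.range_eq_map, ← h,
    Submodule.map_iSup]
  refine iSup_mono fun w => ?_
  rintro _ ⟨x, hx, rfl⟩
  exact map_mem_weightSpace hφ hx

theorem finrank_map_add_finrank_ker_inf (f : E →ₗ[ℂ] F) (A : Submodule ℂ E)
    [FiniteDimensional ℂ A] :
    Module.finrank ℂ (A.map f) + Module.finrank ℂ (A ⊓ LinearMap.ker f : Submodule ℂ E) =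
      Module.finrank ℂ A := by
  rw [← LinearMap.finrank_range_add_finrank_ker (f.domRestrict A), LinearMap.range_domRestrict,
    LinearMap.ker_domRestrict, ← Submodule.finrank_map_subtype_eq A, Submodule.map_comap_subtype]

end WeightSpaces

/-! ### Invariance of the character under passage to cohomology -/

section Cohomology

variable {E H : Type*} [AddCommGroup E] [Module ℂ E] [AddCommGroup H] [Module ℂ H]

theorem isCompl_zmod_two {P : ZMod 2 → Submodule ℂ E} (hP : IsCompl (P 0) (P 1)) (i : ZMod 2) :
    IsCompl (P i) (P (i + 1)) := by
  fin_cases i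
  · exact hP
  · exact hP.symm

theorem projection_map_of_mapsTo {P₀ P₁ : Submodule ℂ E} {Q₀ Q₁ : Submodule ℂ H}
    (hP : IsCompl P₀ P₁) (hQ : IsCompl Q₀ Q₁) {φ : E →ₗ[ℂ] H} (h₀ : ∀ x ∈ P₀, φ x ∈ Q₀)
    (h₁ : ∀ x ∈ P₁, φ x ∈ Q₁) (x : E) :
    φ (P₀.projection P₁ hP x) = Q₀.projection Q₁ hQ (φ x) := by
  conv_rhs => rw [← Submodule.projection_add_projection_eq_self hP x, map_add, map_add]
  rw [Submodule.projection_apply_of_mem_left hQ (h₀ _ (Submodule.projection_apply_mem _ _)),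
    (Submodule.projection_apply_eq_zero_iff hQ).mpr (h₁ _ (Submodule.projection_apply_mem _ _)),
    add_zero]

/-- Passing to the cohomology of an equivariant odd differential does not change the
character. -/
theorem HasCharacter.cohomology {ρ : Representation ℂ Symmetry E} {P : ZMod 2 → Submodule ℂ E}
    {χ : MvPowerSeries (Fin 2) ℤ[T;T⁻¹]} (h : HasCharacter ρ P χ) {d : E →ₗ[ℂ] E}
    (hd : ∀ x, d (d x) = 0) (hdρ : ∀ s x, d (ρ s x) = ρ s (d x))
    (hdP : ∀ i, ∀ x ∈ P i, d x ∈ P (i + 1)) {ρH : Representation ℂ Symmetry H}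
    {Q : LinearMap.ker d →ₗ[ℂ] H} (hQ : Function.Surjective Q)
    (hQker : ∀ x, Q x = 0 ↔ (x : E) ∈ LinearMap.range d)
    (hρH : ∀ s (x y : LinearMap.ker d), (y : E) = ρ s x → ρH s (Q x) = Q y) :
    HasCharacter ρH (fun i => ((P i).comap (LinearMap.ker d).subtype).map Q) χ := by
  have hker : ∀ s, ∀ x ∈ LinearMap.ker d, ρ s x ∈ LinearMap.ker d := fun s x hx => by
    rw [LinearMap.mem_ker] at hx ⊢
    rw [hdρ, hx, map_zero]
  let ρK : Representation ℂ Symmetry (LinearMap.ker d) :=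
    { toFun := fun s => (ρ s).restrict (hker s)
      map_one' := by ext x; simp
      map_mul' := fun s t => by ext x; simp }
  have hKE : ∀ s x, (LinearMap.ker d).subtype (ρK s x) = ρ s ((LinearMap.ker d).subtype x) :=
    fun s x => rfl
  have hKH : ∀ s x, Q (ρK s x) = ρH s (Q x) := fun s x => (hρH s x (ρK s x) rfl).symm
  have topK : ⨆ w : ℤ × ℤ × ℤ, weightSpace ρK w.1 w.2.1 w.2.2 = ⊤ :=
    iSup_weightSpace_of_injective h.iSup_weightSpace hKE (Submodule.subtype_injective _)
      h.iSup_weightSpace hdρ (Submodule.range_subtype _)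
  have topH : ⨆ w : ℤ × ℤ × ℤ, weightSpace ρH w.1 w.2.1 w.2.2 = ⊤ :=
    iSup_weightSpace_of_surjective topK hKH hQ
  have hc := isCompl_zmod_two h.isCompl
  -- The parity projections. As `d` is odd, it intertwines `e i` with `e (i + 1)`.
  set e : ZMod 2 → E →ₗ[ℂ] E := fun i => (P i).projection (P (i + 1)) (hc i)
  have e_mem : ∀ i x, e i x ∈ P i := fun i x => Submodule.projection_apply_mem _ _
  have e_self : ∀ i, ∀ x ∈ P i, e i x = x :=
    fun i x hx => Submodule.projection_apply_of_mem_left _ hx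
  have e_d : ∀ i x, d (e i x) = e (i + 1) (d x) := fun i x =>
    projection_map_of_mapsTo (hc i) (hc (i + 1)) (hdP i) (hdP (i + 1)) x
  have e_ρ : ∀ i s x, e i (ρ s x) = ρ s (e i x) := fun i s x =>
    (projection_map_of_mapsTo (hc i) (hc i) (h.invariant s i) (h.invariant s (i + 1)) x).symm
  have e_add : ∀ x, e 0 x + e 1 x = x := fun x =>
    Submodule.projection_add_projection_eq_self h.isCompl x
  have proj_mem : ∀ w i, ∀ x ∈ P i, weightProj h.iSup_weightSpace w x ∈ P i := fun w i x hx => by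
    have := weightProj_map h.iSup_weightSpace h.iSup_weightSpace (e_ρ i) w x
    rw [e_self i x hx] at this
    rw [← this]
    exact e_mem _ _
  -- A class of weight `w` is represented by a cocycle of weight `w`: projecting any representative
  -- does not change the class, because the quotient map commutes with the projections. Parity
  -- survives as well, by `proj_mem`.
  have key : ∀ (w : ℤ × ℤ × ℤ) (x : LinearMap.ker d),
      Q x ∈ weightSpace ρH w.1 w.2.1 w.2.2 → ∃ y : LinearMap.ker d,
        (y : E) = weightProj h.iSup_weightSpace w x ∧ Q y = Q x := fun w x hx =>
    ⟨weightProj topK w x, weightProj_map topK h.iSup_weightSpace hKE w x, by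
      rw [weightProj_map topK topH hKH w x, weightProj_of_mem topH hx, if_pos rfl]⟩
  have weight_eq : ∀ w : ℤ × ℤ × ℤ, weightSpace ρH w.1 w.2.1 w.2.2 =
      ((weightSpace ρ w.1 w.2.1 w.2.2).comap (LinearMap.ker d).subtype).map Q := by
    intro w
    apply le_antisymm
    · intro y hy
      obtain ⟨x, rfl⟩ := hQ y
      obtain ⟨z, hz, hzx⟩ := key w x hy
      exact ⟨z, by simpa [hz] using weightProj_mem h.iSup_weightSpace w x, hzx⟩
    · rintro _ ⟨x, hx, rfl⟩
      refine map_mem_weightSpace hKH ?_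
      intro p q z
      exact Subtype.ext (hx p q z)
  have weight_inf_eq : ∀ (w : ℤ × ℤ × ℤ) i, weightSpace ρH w.1 w.2.1 w.2.2 ⊓
      ((P i).comap (LinearMap.ker d).subtype).map Q =
      ((weightSpace ρ w.1 w.2.1 w.2.2 ⊓ P i).comap (LinearMap.ker d).subtype).map Q := by
    intro w i
    apply le_antisymm
    · rintro _ ⟨hy, ⟨x, hx, rfl⟩⟩
      obtain ⟨z, hz, hzx⟩ := key w x hy
      refine ⟨z, ⟨?_, ?_⟩, hzx⟩
      · simpa [hz] using weightProj_mem h.iSup_weightSpace w x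
      · simpa [hz] using proj_mem w i x hx
    · refine le_inf ?_ (Submodule.map_mono (Submodule.comap_mono inf_le_right))
      rw [weight_eq]
      exact Submodule.map_mono (Submodule.comap_mono inf_le_left)
  -- A primitive of a boundary homogeneous in weight and parity may be chosen homogeneous: project
  -- any primitive to weight `w` and parity `i`.
  have range_inf : ∀ (w : ℤ × ℤ × ℤ) i,
      (weightSpace ρ w.1 w.2.1 w.2.2 ⊓ P (i + 1)) ⊓ LinearMap.range d =
        (weightSpace ρ w.1 w.2.1 w.2.2 ⊓ P i).map d := by
    intro w i
    apply le_antisymm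
    · rintro _ ⟨⟨hw, hi⟩, ⟨y, rfl⟩⟩
      refine ⟨weightProj h.iSup_weightSpace w (e i y),
        ⟨weightProj_mem _ _ _, proj_mem w i _ (e_mem _ _)⟩, ?_⟩
      rw [weightProj_map h.iSup_weightSpace h.iSup_weightSpace hdρ, e_d, e_self _ _ hi,
        weightProj_of_mem h.iSup_weightSpace hw, if_pos rfl]
    · rintro _ ⟨x, ⟨hw, hi⟩, rfl⟩
      exact ⟨⟨map_mem_weightSpace hdρ hw, hdP i x hi⟩, ⟨x, rfl⟩⟩
  have finite_comap : ∀ A : Submodule ℂ E, FiniteDimensional ℂ A →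
      FiniteDimensional ℂ (A.comap (LinearMap.ker d).subtype) := fun A hA => by
    refine FiniteDimensional.of_injective (V₂ := A)
      ((LinearMap.ker d).subtype.restrict (p := A.comap _) (q := A) fun x hx => hx) ?_
    intro x y hxy
    exact Subtype.ext (Subtype.ext (congrArg (fun z : A => (z : E)) hxy))
  have finite_inf : ∀ (w : ℤ × ℤ × ℤ) i,
      FiniteDimensional ℂ (weightSpace ρ w.1 w.2.1 w.2.2 ⊓ P i : Submodule ℂ E) := fun w i =>
    haveI := h.finite w.1 w.2.1 w.2.2
    Submodule.finiteDimensional_of_le inf_le_left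
  -- Cohomology plus boundaries equals cocycles, in weight `w` and parity `i + 1`.
  have finrank_eq : ∀ (w : ℤ × ℤ × ℤ) i, Module.finrank ℂ (weightSpace ρH w.1 w.2.1 w.2.2 ⊓
      ((P (i + 1)).comap (LinearMap.ker d).subtype).map Q : Submodule ℂ H) +
      Module.finrank ℂ ((weightSpace ρ w.1 w.2.1 w.2.2 ⊓ P i).map d) =
      Module.finrank ℂ ((weightSpace ρ w.1 w.2.1 w.2.2 ⊓ P (i + 1)) ⊓ LinearMap.ker d :
        Submodule ℂ E) := by
    intro w i
    have hf := finite_comap _ (finite_inf w (i + 1))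
    have := finrank_map_add_finrank_ker_inf Q
      ((weightSpace ρ w.1 w.2.1 w.2.2 ⊓ P (i + 1)).comap (LinearMap.ker d).subtype)
    have hinf : (weightSpace ρ w.1 w.2.1 w.2.2 ⊓ P (i + 1)) ⊓ LinearMap.range d =
        ((weightSpace ρ w.1 w.2.1 w.2.2 ⊓ P (i + 1)).comap (LinearMap.ker d).subtype ⊓
          LinearMap.ker Q).map (LinearMap.ker d).subtype := by
      ext x
      constructor
      · rintro ⟨hx, hr⟩
        have hx' : x ∈ LinearMap.ker d := by
          obtain ⟨y, rfl⟩ := hr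
          exact hd y
        exact ⟨⟨x, hx'⟩, ⟨hx, (hQker _).mpr hr⟩, rfl⟩
      · rintro ⟨y, ⟨hy, hr⟩, rfl⟩
        exact ⟨hy, (hQker _).mp hr⟩
    rw [weight_inf_eq, ← range_inf, inf_comm _ (LinearMap.ker d),
      ← Submodule.map_comap_subtype (LinearMap.ker d), Submodule.finrank_map_subtype_eq, ← this,
      hinf, Submodule.finrank_map_subtype_eq]
  refine ⟨?_, ?_, topH, ?_, ?_, ?_⟩
  · constructor
    · rw [Submodule.disjoint_def]
      rintro _ ⟨x, hx, rfl⟩ ⟨y, hy, hxy⟩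
      have : Q (x - y) = 0 := by rw [map_sub, hxy, sub_self]
      obtain ⟨u, hu⟩ := (hQker _).mp this
      -- With `d u = x - y`, `x` even and `y` odd, the even part of the equation reads `d (e 1 u) =
      -- x`.
      refine (hQker _).mpr ⟨e 1 u, ?_⟩
      rw [e_d, hu]
      change e 0 ((x : E) - y) = x
      rw [map_sub, e_self 0 x hx, show e 0 (y : E) = 0 from
        (Submodule.projection_apply_eq_zero_iff (hc 0)).mpr hy, sub_zero]
    · rw [codisjoint_iff, eq_top_iff]
      rintro y -
      obtain ⟨x, rfl⟩ := hQ y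
      have hx : ∀ i, e i x ∈ LinearMap.ker d := fun i => by
        rw [LinearMap.mem_ker, e_d, LinearMap.mem_ker.mp x.2, map_zero]
      have : x = ⟨e 0 x, hx 0⟩ + ⟨e 1 x, hx 1⟩ := Subtype.ext (e_add x).symm
      rw [this, map_add]
      exact Submodule.add_mem_sup ⟨_, e_mem 0 x, rfl⟩ ⟨_, e_mem 1 x, rfl⟩
  · rintro s i _ ⟨x, hx, rfl⟩
    exact ⟨ρK s x, h.invariant s i hx, hKH s x⟩
  · intro j m k
    have := finite_comap _ (h.finite j m k)
    rw [weight_eq (j, m, k)]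
    infer_instance
  · intro j m k hmk
    rw [weight_eq (j, m, k)]
    dsimp only
    rw [h.eq_bot j m k hmk, Submodule.comap_bot, Submodule.ker_subtype, Submodule.map_bot]
  · intro j m k
    rw [h.coeff_eq]
    have h0 := finrank_eq (j, m, k) 1
    have h1 := finrank_eq (j, m, k) 0
    have f0 := finite_inf (j, m, k) 0
    have f1 := finite_inf (j, m, k) 1
    have g0 := finrank_map_add_finrank_ker_inf d (weightSpace ρ j m k ⊓ P 0)
    have g1 := finrank_map_add_finrank_ker_inf d (weightSpace ρ j m k ⊓ P 1)
    rw [show (1 : ZMod 2) + 1 = 0 from rfl] at h0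
    rw [zero_add] at h1
    dsimp only at h0 h1 ⊢
    -- Let `cᵢ` be the dimension of the parity `i` part of the weight space and `bᵢ` the rank of `d`
    -- on it. The cohomology has dimensions `cᵢ - b₀ - b₁`, so the ranks cancel in the difference.
    omega

end Cohomology

/-! ### The signed count of monomials as an infinite product -/

section GeneratingFunction

/-- Labels of the monomials in the `γₙ` and `βₙ`: exponents of the former and a set of the
latter. -/
abbrev MonomialIndex := ((Fin 2 →₀ ℕ) →₀ ℕ) × Finset (Fin 2 →₀ ℕ)

/-- The weight `p ^ (n₁ - n₂) q ^ (n₁ + n₂) z ^ k` of an operator linear in the `n`-th derivative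
of a field with `z`-weight `k`. -/
def jetWeight (k : ℕ) (n : Fin 2 →₀ ℕ) : ℤ × ℕ × ℕ := ((n 0 : ℤ) - n 1, n 0 + n 1, k)

/-- The torus weight of a monomial in the `γₙ` and `βₙ`. -/
noncomputable def monomialWeight (N : ℕ) (b : MonomialIndex) : ℤ × ℕ × ℕ :=
  b.1.sum (fun n i => i • jetWeight 1 n) + ∑ n ∈ b.2, jetWeight N n

/-- The formal monomial attached to a torus weight. -/
noncomputable def weightSeries (w : ℤ × ℕ × ℕ) : MvPowerSeries (Fin 2) ℤ[T;T⁻¹] :=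
  fugacity w.2.2 w.2.1 w.1

/-- The contribution of a monomial in the `γₙ` and `βₙ` to the character. -/
noncomputable def monomialSeries (N : ℕ) (b : MonomialIndex) :
    MvPowerSeries (Fin 2) ℤ[T;T⁻¹] :=
  b.1.prod (fun n i => weightSeries (jetWeight 1 n) ^ i) *
    ∏ n ∈ b.2, -weightSeries (jetWeight N n)

theorem weightSeries_zero : weightSeries 0 = 1 := by
  simp [weightSeries, fugacity]

theorem weightSeries_add (w w' : ℤ × ℕ × ℕ) :
    weightSeries (w + w') = weightSeries w * weightSeries w' := by
  simp only [weightSeries, fugacity, MvPowerSeries.monomial_mul_monomial, Prod.fst_add,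
    Prod.snd_add, LaurentPolynomial.T_add, Finsupp.single_add]
  rw [add_add_add_comm]

theorem weightSeries_nsmul (i : ℕ) (w : ℤ × ℕ × ℕ) :
    weightSeries (i • w) = weightSeries w ^ i := by
  induction i with
  | zero => rw [zero_smul, weightSeries_zero, pow_zero]
  | succ i ih => rw [succ_nsmul, weightSeries_add, ih, pow_succ]

theorem weightSeries_sum {ι : Type*} (s : Finset ι) (f : ι → ℤ × ℕ × ℕ) :
    weightSeries (∑ i ∈ s, f i) = ∏ i ∈ s, weightSeries (f i) := by
  classical
  induction s using Finset.induction_on with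
  | empty => rw [Finset.sum_empty, weightSeries_zero, Finset.prod_empty]
  | insert i s hi ih => rw [Finset.sum_insert hi, weightSeries_add, ih, Finset.prod_insert hi]

theorem monomialSeries_eq (N : ℕ) (b : MonomialIndex) :
    monomialSeries N b = (-1) ^ b.2.card * weightSeries (monomialWeight N b) := by
  rw [monomialSeries, monomialWeight, weightSeries_add, Finsupp.sum, weightSeries_sum,
    weightSeries_sum, Finset.prod_neg]
  simp only [weightSeries_nsmul]
  rw [Finsupp.prod]
  ring

theorem coeff_monomialSeries (N : ℕ) (b : MonomialIndex) (e : Fin 2 →₀ ℕ) :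
    MvPowerSeries.coeff e (monomialSeries N b) =
      if (monomialWeight N b).2 = (e 0, e 1) then
        (-1) ^ b.2.card * LaurentPolynomial.T (monomialWeight N b).1 else 0 := by
  classical
  have h1 : ((-1 : MvPowerSeries (Fin 2) ℤ[T;T⁻¹]) ^ b.2.card) =
      MvPowerSeries.C ((-1) ^ b.2.card) := by simp
  rw [monomialSeries_eq, h1, MvPowerSeries.coeff_C_mul, weightSeries, fugacity,
    MvPowerSeries.coeff_monomial]
  have h2 : e = Finsupp.single 0 (monomialWeight N b).2.1 +
      Finsupp.single 1 (monomialWeight N b).2.2 ↔ (monomialWeight N b).2 = (e 0, e 1) := by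
    rw [Prod.ext_iff]
    constructor
    · intro h
      rw [h]
      simp
    · rintro ⟨h, h'⟩
      rw [h, h']
      ext i
      fin_cases i <;> simp
  simp only [h2]
  split_ifs <;> simp

/-- The derivatives of order at most `m`. -/
noncomputable def jetsUpTo (m : ℕ) : Finset (Fin 2 →₀ ℕ) :=
  (Finset.range (m + 1)).biUnion fun i => Finset.finsuppAntidiag Finset.univ i

theorem mem_jetsUpTo {m : ℕ} {n : Fin 2 →₀ ℕ} : n ∈ jetsUpTo m ↔ n 0 + n 1 ≤ m := by
  simp [jetsUpTo, Finset.mem_finsuppAntidiag]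

theorem monomialWeight_snd (N : ℕ) (b : MonomialIndex) : (monomialWeight N b).2 =
    (b.1.sum (fun n i => i * (n 0 + n 1)) + ∑ n ∈ b.2, (n 0 + n 1),
      b.1.sum (fun _ i => i) + b.2.card * N) := by
  simp [monomialWeight, jetWeight, Finsupp.sum, Prod.snd_sum, Prod.ext_iff, Prod.fst_sum]

/-- All orders are nonnegative, so one factor cannot exceed the total `q`-exponent; as each `γₙ` has
`z`-weight 1, no power of it exceeds the total `z`-exponent. -/
theorem support_subset_jetsUpTo {N : ℕ} {b : MonomialIndex} {m k : ℕ}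
    (h : (monomialWeight N b).2 = (m, k)) :
    b.1.support ⊆ jetsUpTo m ∧ b.2 ⊆ jetsUpTo m ∧ ∀ n, b.1 n ≤ k := by
  rw [monomialWeight_snd, Prod.mk.injEq, Finsupp.sum, Finsupp.sum] at h
  obtain ⟨h1, h2⟩ := h
  refine ⟨fun n hn => mem_jetsUpTo.mpr ?_, fun n hn => mem_jetsUpTo.mpr ?_, fun n => ?_⟩
  · have := Finset.single_le_sum (f := fun n => b.1 n * (n 0 + n 1)) (fun _ _ => Nat.zero_le _) hn
    have h0 : 1 ≤ b.1 n := Nat.one_le_iff_ne_zero.mpr (Finsupp.mem_support_iff.mp hn)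
    have := Nat.mul_le_mul_right (n 0 + n 1) h0
    omega
  · have := Finset.single_le_sum (f := fun n : Fin 2 →₀ ℕ => n 0 + n 1)
      (fun _ _ => Nat.zero_le _) hn
    omega
  · by_cases hn : n ∈ b.1.support
    · have := Finset.single_le_sum (f := fun n => b.1 n) (fun _ _ => Nat.zero_le _) hn
      omega
    · rw [Finsupp.notMem_support_iff.mp hn]
      exact Nat.zero_le _

theorem finite_monomialWeight_snd (N m k : ℕ) :
    {b : MonomialIndex | (monomialWeight N b).2 = (m, k)}.Finite := by
  refine ((Finset.finsupp (jetsUpTo m) fun _ => Finset.range (k + 1)) ×ˢ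
    (jetsUpTo m).powerset).finite_toSet.subset fun b hb => ?_
  obtain ⟨h1, h2, h3⟩ := support_subset_jetsUpTo hb
  rw [Finset.mem_coe, Finset.mem_product, Finset.mem_finsupp_iff, Finset.mem_powerset]
  exact ⟨⟨h1, fun n _ => Finset.mem_range.mpr (Nat.lt_succ_of_le (h3 n))⟩, h2⟩

/-- The signed count by weight of a set of monomials. -/
noncomputable def signedCount (N : ℕ) (X : Set MonomialIndex) :
    MvPowerSeries (Fin 2) ℤ[T;T⁻¹] :=
  fun e => ∑ᶠ b, MvPowerSeries.coeff e (X.indicator (monomialSeries N) b)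

theorem coeff_signedCount (N : ℕ) (X : Set MonomialIndex) (e : Fin 2 →₀ ℕ) :
    MvPowerSeries.coeff e (signedCount N X) =
      ∑ᶠ b, MvPowerSeries.coeff e (X.indicator (monomialSeries N) b) := rfl

theorem coeff_indicator_monomialSeries_eq_zero {N : ℕ} {X : Set MonomialIndex}
    {e : Fin 2 →₀ ℕ} {b : MonomialIndex} (h : (monomialWeight N b).2 ≠ (e 0, e 1)) :
    MvPowerSeries.coeff e (X.indicator (monomialSeries N) b) = 0 := by
  by_cases hb : b ∈ X
  · rw [Set.indicator_of_mem hb, coeff_monomialSeries, if_neg h]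
  · rw [Set.indicator_of_notMem hb, map_zero]

theorem support_coeff_indicator_finite (N : ℕ) (X : Set MonomialIndex) (e : Fin 2 →₀ ℕ) :
    (Function.support fun b =>
      MvPowerSeries.coeff e (X.indicator (monomialSeries N) b)).Finite := by
  refine (finite_monomialWeight_snd N (e 0) (e 1)).subset fun b hb => ?_
  by_contra h
  exact hb (coeff_indicator_monomialSeries_eq_zero h)

/-- Each coefficient is a finite sum, which gives convergence in the product topology. Identities
between counts then follow from uniqueness of sums. -/
theorem hasSum_signedCount (N : ℕ) (X : Set MonomialIndex) :
    HasSum (X.indicator (monomialSeries N)) (signedCount N X) := by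
  rw [MvPowerSeries.WithPiTopology.hasSum_iff_hasSum_coeff]
  intro e
  rw [coeff_signedCount, finsum_eq_sum _ (support_coeff_indicator_finite N X e)]
  refine hasSum_sum_of_ne_finset_zero fun b hb => ?_
  by_contra h
  exact hb ((Set.Finite.mem_toFinset _).mpr h)

theorem signedCount_union {N : ℕ} {X Y : Set MonomialIndex} (h : Disjoint X Y) :
    signedCount N (X ∪ Y) = signedCount N X + signedCount N Y := by
  refine (hasSum_signedCount N _).unique ?_
  rw [Set.indicator_union_of_disjoint h]
  exact (hasSum_signedCount N X).add (hasSum_signedCount N Y)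

theorem signedCount_image {N : ℕ} {X : Set MonomialIndex} {φ : MonomialIndex → MonomialIndex}
    (hφ : Function.Injective φ) {u : MvPowerSeries (Fin 2) ℤ[T;T⁻¹]}
    (hu : ∀ b ∈ X, monomialSeries N (φ b) = u * monomialSeries N b) :
    signedCount N (φ '' X) = u * signedCount N X := by
  refine (hasSum_signedCount N _).unique ?_
  rw [← hφ.hasSum_iff]
  · refine ((hasSum_signedCount N X).mul_left u).congr_fun ?_
    intro b
    by_cases hb : b ∈ X
    · rw [Function.comp_apply, Set.indicator_of_mem (Set.mem_image_of_mem φ hb),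
        Set.indicator_of_mem hb, hu b hb]
    · rw [Function.comp_apply, Set.indicator_of_notMem, Set.indicator_of_notMem hb, mul_zero]
      rwa [hφ.mem_set_image]
  · intro b hb
    refine Set.indicator_of_notMem (fun h => hb ?_) _
    exact Set.image_subset_range _ _ h

/-- The monomials in the `γₙ` with `n ∈ s` and the `βₙ` with `n ∈ t`. -/
def monomialsIn (s t : Finset (Fin 2 →₀ ℕ)) : Set MonomialIndex :=
  {b | b.1.support ⊆ s ∧ b.2 ⊆ t}

theorem signedCount_monomialsIn_empty (N : ℕ) : signedCount N (monomialsIn ∅ ∅) = 1 := by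
  have h : monomialsIn ∅ ∅ = {((0, ∅) : MonomialIndex)} := by
    ext ⟨a, S⟩
    simp [monomialsIn]
  refine (hasSum_signedCount N _).unique ?_
  rw [h]
  have h1 := hasSum_single (f := Set.indicator {((0, ∅) : MonomialIndex)} (monomialSeries N))
    (0, ∅) fun b hb => Set.indicator_of_notMem (s := {((0, ∅) : MonomialIndex)}) hb _
  rw [Set.indicator_of_mem (Set.mem_singleton _)] at h1
  simpa [monomialSeries] using h1

theorem monomialSeries_add_single (N : ℕ) (x : Fin 2 →₀ ℕ) (b : MonomialIndex) :
    monomialSeries N (b.1 + Finsupp.single x 1, b.2) =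
      weightSeries (jetWeight 1 x) * monomialSeries N b := by
  rw [monomialSeries, monomialSeries, Finsupp.prod_add_index' (h := fun n i => weightSeries (jetWeight 1 n) ^ i)
    (fun _ => pow_zero _) (fun _ _ _ => pow_add _ _ _),
    Finsupp.prod_single_index (h := fun n i => weightSeries (jetWeight 1 n) ^ i) (pow_zero _),
    pow_one]
  ring

/-- A monomial either avoids `γₓ` or is `γₓ` times a unique monomial of the same kind, so the count
`F` satisfies `F = F' + u F`, with `F'` the count without `γₓ` and `u` the series of `γₓ`. This sums
the geometric series without division. -/
theorem signedCount_monomialsIn_insert_left {N : ℕ} {s t : Finset (Fin 2 →₀ ℕ)}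
    {x : Fin 2 →₀ ℕ} (hx : x ∉ s) :
    (1 - weightSeries (jetWeight 1 x)) * signedCount N (monomialsIn (insert x s) t) =
      signedCount N (monomialsIn s t) := by
  have hinj : Function.Injective
      (fun b : MonomialIndex => ((b.1 + Finsupp.single x 1, b.2) : MonomialIndex)) := by
    rintro ⟨a, S⟩ ⟨a', S'⟩ h
    simpa using h
  have hunion : monomialsIn (insert x s) t = monomialsIn s t ∪
      (fun b : MonomialIndex => ((b.1 + Finsupp.single x 1, b.2) : MonomialIndex)) ''
        monomialsIn (insert x s) t := by
    ext ⟨a, S⟩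
    constructor
    · rintro ⟨ha, hS⟩
      by_cases hax : a x = 0
      · refine Or.inl ⟨fun n hn => ?_, hS⟩
        refine (Finset.mem_insert.mp (ha hn)).resolve_left ?_
        rintro rfl
        exact Finsupp.mem_support_iff.mp hn hax
      · have hle : Finsupp.single x 1 ≤ a := by
          rw [Finsupp.single_le_iff]
          exact Nat.one_le_iff_ne_zero.mpr hax
        exact Or.inr ⟨(a - Finsupp.single x 1, S),
          ⟨(Finsupp.support_mono tsub_le_self).trans ha, hS⟩,
          Prod.ext (tsub_add_cancel_of_le hle) rfl⟩
    · rintro (⟨ha, hS⟩ | ⟨⟨a', S'⟩, ⟨ha, hS⟩, h⟩)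
      · exact ⟨ha.trans (Finset.subset_insert _ _), hS⟩
      · rw [← h]
        refine ⟨(Finsupp.support_add).trans (Finset.union_subset ha ?_), hS⟩
        exact Finsupp.support_single_subset.trans (by simp)
  have hdisj : Disjoint (monomialsIn s t)
      ((fun b : MonomialIndex => ((b.1 + Finsupp.single x 1, b.2) : MonomialIndex)) ''
        monomialsIn (insert x s) t) := by
    rw [Set.disjoint_left]
    rintro _ ⟨ha, -⟩ ⟨b, -, rfl⟩
    exact hx (ha (by simp))
  have h := signedCount_union (N := N) hdisj
  rw [← hunion, signedCount_image hinj fun b _ => monomialSeries_add_single N x b] at h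
  rw [sub_mul, one_mul, sub_eq_iff_eq_add]
  exact h

/-- A monomial either avoids `βₓ` or contains it exactly once, and in the second case its sign is
reversed. -/
theorem signedCount_monomialsIn_insert_right {N : ℕ} {s t : Finset (Fin 2 →₀ ℕ)}
    {x : Fin 2 →₀ ℕ} (hx : x ∉ t) :
    signedCount N (monomialsIn s (insert x t)) =
      (1 - weightSeries (jetWeight N x)) * signedCount N (monomialsIn s t) := by
  have hins : ∀ S : Finset (Fin 2 →₀ ℕ), x ∉ S → symmDiff S {x} = insert x S := by
    intro S hS
    ext n
    rw [Finset.mem_symmDiff, Finset.mem_singleton, Finset.mem_insert]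
    by_cases hn : n = x
    · subst hn; simp [hS]
    · simp [hn]
  -- Toggling `x` is injective on all finite sets, as `signedCount_image` demands, whereas inserting
  -- `x` is not; the two agree on sets that omit `x`.
  have hinj : Function.Injective
      (fun b : MonomialIndex => ((b.1, symmDiff b.2 {x}) : MonomialIndex)) := by
    rintro ⟨a, S⟩ ⟨a', S'⟩ h
    simpa using h
  have hunion : monomialsIn s (insert x t) = monomialsIn s t ∪
      (fun b : MonomialIndex => ((b.1, symmDiff b.2 {x}) : MonomialIndex)) ''
        monomialsIn s t := by
    ext ⟨a, S⟩
    constructor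
    · rintro ⟨ha, hS⟩
      by_cases hxS : x ∈ S
      · refine Or.inr ⟨(a, S.erase x), ⟨ha, Finset.subset_insert_iff.mp hS⟩, ?_⟩
        dsimp only
        rw [hins _ (Finset.notMem_erase x S), Finset.insert_erase hxS]
      · exact Or.inl ⟨ha, (Finset.subset_insert_iff_of_notMem hxS).mp hS⟩
    · rintro (⟨ha, hS⟩ | ⟨⟨a', S'⟩, ⟨ha, hS⟩, h⟩)
      · exact ⟨ha, hS.trans (Finset.subset_insert _ _)⟩
      · rw [← h]
        dsimp only
        rw [hins _ (fun h => hx (hS h))]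
        exact ⟨ha, Finset.insert_subset_insert x hS⟩
  have hdisj : Disjoint (monomialsIn s t)
      ((fun b : MonomialIndex => ((b.1, symmDiff b.2 {x}) : MonomialIndex)) ''
        monomialsIn s t) := by
    rw [Set.disjoint_left]
    rintro _ ⟨-, hS⟩ ⟨b, ⟨-, hb⟩, rfl⟩
    dsimp only at hS
    rw [hins _ (fun h => hx (hb h))] at hS
    exact hx (hS (Finset.mem_insert_self _ _))
  rw [hunion, signedCount_union hdisj,
    signedCount_image (u := -weightSeries (jetWeight N x)) hinj]
  · ring
  · rintro ⟨a, S⟩ ⟨-, hS⟩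
    have hxS : x ∉ S := fun h => hx (hS h)
    rw [monomialSeries, monomialSeries]
    dsimp only
    rw [hins _ hxS, Finset.prod_insert hxS]
    ring

theorem constantCoeff_weightSeries_jetWeight (x : Fin 2 →₀ ℕ) :
    MvPowerSeries.constantCoeff (1 - weightSeries (jetWeight 1 x)) = 1 := by
  classical
  rw [map_sub, map_one, weightSeries, fugacity, jetWeight,
    ← MvPowerSeries.coeff_zero_eq_constantCoeff_apply, MvPowerSeries.coeff_monomial, if_neg,
    sub_zero]
  intro h
  simpa using DFunLike.congr_fun h 1

/-- The factor of the character contributed by the `n`-th derivatives of `γ` and `β`. -/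
noncomputable def jetFactor (N : ℕ) (n : Fin 2 →₀ ℕ) : MvPowerSeries (Fin 2) ℤ[T;T⁻¹] :=
  (1 - weightSeries (jetWeight N n)) *
    MvPowerSeries.invOfUnit (1 - weightSeries (jetWeight 1 n)) 1

theorem prod_jetFactor (N : ℕ) (s : Finset (Fin 2 →₀ ℕ)) :
    ∏ n ∈ s, jetFactor N n = signedCount N (monomialsIn s s) := by
  induction s using Finset.induction_on with
  | empty => rw [Finset.prod_empty, signedCount_monomialsIn_empty]
  | insert x s hx ih =>
    have h := MvPowerSeries.invOfUnit_mul (1 - weightSeries (jetWeight 1 x)) 1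
      (constantCoeff_weightSeries_jetWeight x)
    rw [Finset.prod_insert hx, ih, signedCount_monomialsIn_insert_right hx, jetFactor,
      ← signedCount_monomialsIn_insert_left (t := s) hx]
    linear_combination (1 - weightSeries (jetWeight N x)) *
      signedCount N (monomialsIn (insert x s) s) * h

/-- The coefficient with `q`-exponent `m` involves only derivatives of order at most `m`, so it is
constant once the finite set of factors contains `jetsUpTo m`. -/
theorem hasProd_jetFactor (N : ℕ) : HasProd (jetFactor N) (signedCount N Set.univ) := by
  rw [HasProd, SummationFilter.unconditional_filter,
    MvPowerSeries.WithPiTopology.tendsto_iff_coeff_tendsto]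
  intro e
  refine tendsto_nhds_of_eventually_eq ?_
  filter_upwards [Filter.eventually_ge_atTop (jetsUpTo (e 0))] with s hs
  rw [prod_jetFactor, coeff_signedCount, coeff_signedCount]
  refine finsum_congr fun b => ?_
  by_cases hb : (monomialWeight N b).2 = (e 0, e 1)
  · obtain ⟨h1, h2, -⟩ := support_subset_jetsUpTo hb
    rw [Set.indicator_of_mem (Set.mem_univ b),
      Set.indicator_of_mem (s := monomialsIn s s) ⟨h1.trans hs, h2.trans hs⟩]
  · rw [coeff_indicator_monomialSeries_eq_zero hb, coeff_indicator_monomialSeries_eq_zero hb]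

/-- Derivatives on `ℂ²` labelled by their order `m` and the number `ℓ ≤ m` of times that `∂₁`
occurs. -/
noncomputable def jetEquiv : (Σ m : ℕ, Fin (m + 1)) ≃ (Fin 2 →₀ ℕ) :=
  Equiv.ofBijective
    (fun x => Finsupp.single 0 (x.2 : ℕ) + Finsupp.single 1 (x.1 - (x.2 : ℕ))) (by
      constructor
      · rintro ⟨m, l⟩ ⟨m', l'⟩ h
        have h0 := DFunLike.congr_fun h 0
        have h1 := DFunLike.congr_fun h 1
        simp at h0 h1
        have := l.2
        have := l'.2
        obtain rfl : m = m' := by omega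
        rw [Fin.ext h0]
      · intro n
        refine ⟨⟨n 0 + n 1, ⟨n 0, by omega⟩⟩, ?_⟩
        ext i
        fin_cases i <;> simp)

/-- The label `(m, ℓ)` stands for the derivative with exponents `(ℓ, m - ℓ)`, whose `p`-weight is `ℓ
- (m - ℓ) = 2ℓ - m`. -/
theorem characterFactor_eq (N : ℕ) (x : Σ m : ℕ, Fin (m + 1)) :
    characterFactor N x = jetFactor N (jetEquiv x) := by
  obtain ⟨m, l⟩ := x
  have hl := l.2
  have h : ∀ k, weightSeries (jetWeight k (jetEquiv ⟨m, l⟩)) = fugacity k m (2 * (l : ℤ) - m) := by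
    intro k
    have h0 : jetEquiv ⟨m, l⟩ 0 = l := by simp [jetEquiv]
    have h1 : jetEquiv ⟨m, l⟩ 1 = m - l := by simp [jetEquiv]
    rw [weightSeries, jetWeight, h0, h1]
    dsimp only
    congr 1 <;> omega
  rw [characterFactor, jetFactor, h, h]

theorem hasProd_characterFactor (N : ℕ) :
    HasProd (characterFactor N) (signedCount N Set.univ) := by
  have : characterFactor N = jetFactor N ∘ jetEquiv := funext (characterFactor_eq N)
  rw [this, jetEquiv.hasProd_iff]
  exact hasProd_jetFactor N

/-- The sign of a monomial is the parity of its number of `β` factors, so a coefficient is the even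
count minus the odd one, the form needed by `HasCharacter.of_basis`. -/
theorem coeff_coeff_signedCount_univ (N : ℕ) (j : ℤ) (m k : ℕ) :
    (MvPowerSeries.coeff (Finsupp.single 0 m + Finsupp.single 1 k)
      (signedCount N Set.univ)).coeff j =
      ({b | monomialWeight N b = (j, m, k) ∧ (b.2.card : ZMod 2) = 0}.ncard : ℤ) -
        {b | monomialWeight N b = (j, m, k) ∧ (b.2.card : ZMod 2) = 1}.ncard := by
  classical
  have hfin := finite_monomialWeight_snd N m k
  set s := hfin.toFinset with hs
  have hmem : ∀ b, b ∈ s ↔ (monomialWeight N b).2 = (m, k) := fun b => by simp [hs]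
  have hcoeff : MvPowerSeries.coeff (Finsupp.single 0 m + Finsupp.single 1 k)
      (signedCount N Set.univ) =
      ∑ b ∈ s, (-1) ^ b.2.card * LaurentPolynomial.T (monomialWeight N b).1 := by
    rw [coeff_signedCount, finsum_eq_sum_of_support_subset (s := s)]
    · refine Finset.sum_congr rfl fun b hb => ?_
      rw [Set.indicator_of_mem (Set.mem_univ b), coeff_monomialSeries, if_pos]
      simpa using (hmem b).mp hb
    · intro b hb
      rw [Finset.mem_coe, hmem]
      by_contra h
      exact hb (coeff_indicator_monomialSeries_eq_zero (by simpa using h))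
  have hsets : ∀ i : ZMod 2, ({b | monomialWeight N b = (j, m, k) ∧ (b.2.card : ZMod 2) = i} :
      Set MonomialIndex) =
      (s.filter fun b => monomialWeight N b = (j, m, k) ∧ (b.2.card : ZMod 2) = i) := by
    intro i
    ext b
    simp only [Set.mem_ofPred_eq, Finset.coe_filter, hmem, iff_and_self]
    rintro ⟨h, -⟩
    rw [h]
  rw [hcoeff, hsets, hsets, Set.ncard_coe_finset, Set.ncard_coe_finset, Finset.card_filter,
    Finset.card_filter, Nat.cast_sum, Nat.cast_sum, ← Finset.sum_sub_distrib]
  rw [AddMonoidAlgebra.coeff_sum, Finsupp.finsetSum_apply]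
  refine Finset.sum_congr rfl fun b hb => ?_
  rw [hmem] at hb
  have hw : monomialWeight N b = (j, m, k) ↔ (monomialWeight N b).1 = j := by
    rw [Prod.ext_iff, hb]; simp
  have hT : ∀ n : ℤ, (LaurentPolynomial.T n : ℤ[T;T⁻¹]).coeff j = if n = j then 1 else 0 :=
    fun n => Finsupp.single_apply
  simp only [hw]
  rcases Nat.even_or_odd b.2.card with h | h
  · rw [h.neg_one_pow, one_mul, hT, (ZMod.natCast_eq_zero_iff_even).mpr h]
    simp
  · rw [h.neg_one_pow, neg_one_mul, (ZMod.natCast_eq_one_iff_odd).mpr h,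
      AddMonoidAlgebra.coeff_neg, Finsupp.neg_apply, hT]
    simp

end GeneratingFunction

/-! ### Reading a character off a basis of weight vectors -/

section WeightBasis

variable {E : Type*} [AddCommGroup E] [Module ℂ E]

theorem finrank_span_image_eq_ncard {ι : Type*} (b : Module.Basis ι ℂ E) {s : Set ι}
    (hs : s.Finite) : Module.finrank ℂ (Submodule.span ℂ (b '' s)) = s.ncard := by
  have := hs.fintype
  have h := finrank_span_eq_card (b.linearIndependent.comp (fun x : s => x.1) Subtype.val_injective)
  rwa [← Set.toFinset_card, ← Set.ncard_eq_toFinset_card', Set.range_comp, Subtype.range_coe] at h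

/-- The character of a representation with a homogeneous basis of weight vectors counts the
elements of the basis. -/
theorem HasCharacter.of_basis {ρ : Representation ℂ Symmetry E} {P : ZMod 2 → Submodule ℂ E}
    {χ : MvPowerSeries (Fin 2) ℤ[T;T⁻¹]} (hP : IsCompl (P 0) (P 1))
    (hinv : ∀ s i, P i ≤ (P i).comap (ρ s)) {ι : Type*} (b : Module.Basis ι ℂ E)
    (wt : ι → ℤ × ℕ × ℕ) (par : ι → ZMod 2)
    (hwt : ∀ a, b a ∈ weightSpace ρ (wt a).1 (wt a).2.1 (wt a).2.2) (hpar : ∀ a, b a ∈ P (par a))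
    (hfin : ∀ w, {a | wt a = w}.Finite)
    (hχ : ∀ (j : ℤ) (m k : ℕ),
      (MvPowerSeries.coeff (Finsupp.single 0 m + Finsupp.single 1 k) χ).coeff j =
        ({a | wt a = (j, m, k) ∧ par a = 0}.ncard : ℤ) -
          {a | wt a = (j, m, k) ∧ par a = 1}.ncard) :
    HasCharacter ρ P χ := by
  let zwt : ι → ℤ × ℤ × ℤ := fun a => ((wt a).1, (wt a).2.1, (wt a).2.2)
  have htop : ⨆ w : ℤ × ℤ × ℤ, weightSpace ρ w.1 w.2.1 w.2.2 = ⊤ := by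
    rw [eq_top_iff, ← b.span_eq, Submodule.span_le]
    rintro _ ⟨a, rfl⟩
    exact Submodule.mem_iSup_of_mem (zwt a) (hwt a)
  -- The projection keeps or kills each basis vector; hence a weight space contains nothing beyond
  -- the span of the basis vectors of its weight.
  have hproj : ∀ w x, weightProj htop w x ∈ Submodule.span ℂ (b '' {a | zwt a = w}) := by
    intro w x
    induction (b.span_eq ▸ Submodule.mem_top : x ∈ Submodule.span ℂ (Set.range b))
      using Submodule.span_induction with
    | mem x hx =>
      obtain ⟨a, rfl⟩ := hx
      rw [weightProj_of_mem htop (w' := zwt a) (hwt a)]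
      split_ifs with h
      · exact Submodule.subset_span ⟨a, h, rfl⟩
      · exact zero_mem _
    | zero => rw [map_zero]; exact zero_mem _
    | add x y _ _ hx hy => rw [map_add]; exact add_mem hx hy
    | smul c x _ hx => rw [map_smul]; exact Submodule.smul_mem _ _ hx
  have hweight : ∀ w : ℤ × ℤ × ℤ, weightSpace ρ w.1 w.2.1 w.2.2 =
      Submodule.span ℂ (b '' {a | zwt a = w}) := by
    intro w
    apply le_antisymm
    · intro x hx
      have := hproj w x
      rwa [weightProj_of_mem htop hx, if_pos rfl] at this
    · rw [Submodule.span_le]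
      rintro _ ⟨a, rfl, rfl⟩
      exact hwt a
  have hc := isCompl_zmod_two hP
  have hweightP : ∀ (w : ℤ × ℤ × ℤ) i, weightSpace ρ w.1 w.2.1 w.2.2 ⊓ P i =
      Submodule.span ℂ (b '' {a | zwt a = w ∧ par a = i}) := by
    intro w i
    apply le_antisymm
    · rintro x ⟨hw, hi⟩
      rw [SetLike.mem_coe, hweight] at hw
      rw [← Submodule.projection_apply_of_mem_left (hc i) hi]
      have : (P i).projection (P (i + 1)) (hc i) x ∈ (Submodule.span ℂ (b '' {a | zwt a = w})).map
          ((P i).projection (P (i + 1)) (hc i)) := Submodule.mem_map_of_mem hw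
      rw [Submodule.map_span] at this
      refine Submodule.span_le.mpr ?_ this
      rintro _ ⟨_, ⟨a, ha, rfl⟩, rfl⟩
      by_cases hai : par a = i
      · rw [Submodule.projection_apply_of_mem_left (hc i) (hai ▸ hpar a)]
        exact Submodule.subset_span ⟨a, ⟨ha, hai⟩, rfl⟩
      -- With only two parities, a basis vector of the wrong one lies in the complementary summand,
      -- which the projection kills.
      · have h1 : ∀ x y : ZMod 2, x ≠ y → x = y + 1 := by decide
        rw [(Submodule.projection_apply_eq_zero_iff (hc i)).mpr (h1 _ _ hai ▸ hpar a)]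
        exact zero_mem _
    · rw [Submodule.span_le]
      rintro _ ⟨a, ⟨rfl, rfl⟩, rfl⟩
      exact ⟨hwt a, hpar a⟩
  have hzwt : ∀ a (j : ℤ) (m k : ℕ), zwt a = (j, (m : ℤ), (k : ℤ)) ↔ wt a = (j, m, k) := by
    intro a j m k
    simp [zwt, Prod.ext_iff]
  have hneg : ∀ j m k : ℤ, m < 0 ∨ k < 0 → {a | zwt a = (j, m, k)} = ∅ := by
    intro j m k hmk
    rw [Set.eq_empty_iff_forall_notMem]
    intro a ha
    have h1 : ((wt a).2.1 : ℤ) = m := congrArg (fun w => w.2.1) ha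
    have h2 : ((wt a).2.2 : ℤ) = k := congrArg (fun w => w.2.2) ha
    omega
  have hzfin : ∀ w, {a | zwt a = w}.Finite := by
    rintro ⟨j, m, k⟩
    by_cases hmk : m < 0 ∨ k < 0
    · rw [hneg j m k hmk]
      exact Set.finite_empty
    · lift m to ℕ using by omega
      lift k to ℕ using by omega
      simp only [hzwt]
      exact hfin _
  refine ⟨hP, hinv, htop, ?_, ?_, ?_⟩
  · intro j m k
    rw [hweight (j, m, k)]
    exact FiniteDimensional.span_of_finite ℂ ((hzfin _).image _)
  · intro j m k hmk
    rw [hweight (j, m, k), hneg j m k hmk, Set.image_empty, Submodule.span_empty]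
  · intro j m k
    rw [hχ, hweightP (j, m, k), hweightP (j, m, k),
      finrank_span_image_eq_ncard b ((hzfin (j, m, k)).subset fun a ha => ha.1),
      finrank_span_image_eq_ncard b ((hzfin (j, m, k)).subset fun a ha => ha.1)]
    simp only [hzwt]

end WeightBasis

/-! ### Exterior algebras: basis and parity -/

section ExteriorBasis

variable {A M : Type*} [CommRing A] [AddCommGroup M] [Module A M]

/-- The exterior algebra of a free module has a basis of ordered products of generators. -/
theorem exists_exteriorAlgebra_basis {I : Type*} (b : Module.Basis I A M) :
    ∃ B : Module.Basis (Finset I) A (ExteriorAlgebra A M), ∀ s : Finset I, ∃ l : List I,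
      (l : Multiset I) = s.val ∧ B s = (l.map fun i => ExteriorAlgebra.ι A (b i)).prod := by
  classical
  -- Any order will do: the conclusion fixes the list of factors only up to permutation, which is
  -- all that weight and parity depend on.
  let : LinearOrder I := linearOrderOfSTO WellOrderingRel
  refine ⟨b.ExteriorAlgebra, fun s => ⟨List.ofFn (s.orderEmbOfFin rfl), ?_, ?_⟩⟩
  · refine (Multiset.Nodup.ext ?_ s.nodup).mpr fun i => ?_
    · exact Multiset.coe_nodup.mpr (List.nodup_ofFn.mpr (s.orderEmbOfFin rfl).injective)
    · have := Set.ext_iff.mp (Finset.range_orderEmbOfFin s rfl) i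
      rwa [Multiset.mem_coe, List.mem_ofFn]
  · rw [ExteriorAlgebra.basis_apply_ofCard b rfl, List.map_ofFn]
    exact ExteriorAlgebra.ιMulti_apply _

/-- Induction on words, two generators at a time, applying the antiderivation rule to each. This
makes `sInt` odd. -/
theorem contractLeft_mem_evenOdd {Q : QuadraticForm A M} (d : Module.Dual A M) (i : ZMod 2)
    {x : CliffordAlgebra Q} (hx : x ∈ CliffordAlgebra.evenOdd Q i) :
    CliffordAlgebra.contractLeft d x ∈ CliffordAlgebra.evenOdd Q (i + 1) := by
  have hmul : ∀ m₁ m₂ x, x ∈ CliffordAlgebra.evenOdd Q i →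
      CliffordAlgebra.contractLeft d x ∈ CliffordAlgebra.evenOdd Q (i + 1) →
      CliffordAlgebra.contractLeft d (CliffordAlgebra.ι Q m₁ * CliffordAlgebra.ι Q m₂ * x) ∈
        CliffordAlgebra.evenOdd Q (i + 1) := by
    intro m₁ m₂ x hx ih
    have h1 : ∀ m j y, y ∈ CliffordAlgebra.evenOdd Q j →
        CliffordAlgebra.ι Q m * y ∈ CliffordAlgebra.evenOdd Q (j + 1) := fun m j y hy => by
      rw [add_comm j]
      exact SetLike.mul_mem_graded (CliffordAlgebra.ι_mem_evenOdd_one Q m) hy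
    rw [mul_assoc, CliffordAlgebra.contractLeft_ι_mul, CliffordAlgebra.contractLeft_ι_mul]
    refine sub_mem (Submodule.smul_mem _ _ (h1 _ _ _ hx)) (h1 _ _ _ (sub_mem
      (Submodule.smul_mem _ _ hx) ?_))
    have := h1 m₂ _ _ ih
    rwa [add_assoc, show (1 : ZMod 2) + 1 = 0 from rfl, add_zero] at this
  fin_cases i
  · induction x, hx using CliffordAlgebra.even_induction with
    | algebraMap r => rw [CliffordAlgebra.contractLeft_algebraMap]; exact zero_mem _
    | add x y _ _ hx hy => rw [map_add]; exact add_mem hx hy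
    | ι_mul_ι_mul m₁ m₂ x hx ih => exact hmul m₁ m₂ x hx ih
  · induction x, hx using CliffordAlgebra.odd_induction with
    | ι v =>
      rw [CliffordAlgebra.contractLeft_ι]
      exact CliffordAlgebra.one_le_evenOdd_zero Q (Submodule.algebraMap_mem _)
    | add x y _ _ hx hy => rw [map_add]; exact add_mem hx hy
    | ι_mul_ι_mul m₁ m₂ x hx ih => exact hmul m₁ m₂ x hx ih

/-- The map is multiplicative and sends generators to generators and scalars to scalars, so it
preserves the parity of word length. It makes both parity subspaces invariant under the symmetry
group. -/
theorem exteriorMap_mem_evenOdd (σ : A →+* A) (f : M →ₛₗ[σ] M) (i : ZMod 2)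
    {x : ExteriorAlgebra A M} (hx : x ∈ CliffordAlgebra.evenOdd (0 : QuadraticForm A M) i) :
    exteriorMap σ f x ∈ CliffordAlgebra.evenOdd (0 : QuadraticForm A M) i := by
  have e₁ : ∀ v, exteriorMap σ f (CliffordAlgebra.ι 0 v) = CliffordAlgebra.ι 0 (f v) :=
    exteriorMap_ι σ f
  have e₃ : ∀ y z : CliffordAlgebra (0 : QuadraticForm A M), exteriorMap σ f (y * z) =
      (exteriorMap σ f y : CliffordAlgebra (0 : QuadraticForm A M)) * exteriorMap σ f z :=
    fun y z => (exteriorMap σ f).map_mul y z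
  have hmul : ∀ m₁ m₂ (x : CliffordAlgebra (0 : QuadraticForm A M)),
      exteriorMap σ f x ∈ CliffordAlgebra.evenOdd (0 : QuadraticForm A M) i →
      exteriorMap σ f (CliffordAlgebra.ι 0 m₁ * CliffordAlgebra.ι 0 m₂ * x :
        CliffordAlgebra (0 : QuadraticForm A M)) ∈
        CliffordAlgebra.evenOdd (0 : QuadraticForm A M) i := by
    intro m₁ m₂ x ih
    rw [e₃, e₃, e₁, e₁]
    have := SetLike.mul_mem_graded (CliffordAlgebra.ι_mul_ι_mem_evenOdd_zero 0 (f m₁) (f m₂)) ih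
    rwa [zero_add] at this
  fin_cases i
  · induction x, hx using CliffordAlgebra.even_induction with
    | algebraMap r =>
      have e := exteriorMap_algebraMap σ f r
      refine Eq.mpr (congrArg (· ∈ _) e)
        (CliffordAlgebra.one_le_evenOdd_zero 0 (Submodule.algebraMap_mem _))
    | add x y _ _ hx hy =>
      exact Eq.mpr (congrArg (· ∈ _) ((exteriorMap σ f).map_add x y)) (add_mem hx hy)
    | ι_mul_ι_mul m₁ m₂ x hx ih => exact hmul m₁ m₂ x ih
  · induction x, hx using CliffordAlgebra.odd_induction with
    | ι v => exact Eq.mpr (congrArg (· ∈ _) (e₁ v)) (CliffordAlgebra.ι_mem_evenOdd_one 0 (f v))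
    | add x y _ _ hx hy =>
      exact Eq.mpr (congrArg (· ∈ _) ((exteriorMap σ f).map_add x y)) (add_mem hx hy)
    | ι_mul_ι_mul m₁ m₂ x hx ih => exact hmul m₁ m₂ x ih

theorem list_prod_ι_mem_evenOdd (l : List M) :
    (l.map (ExteriorAlgebra.ι A)).prod ∈
      CliffordAlgebra.evenOdd (0 : QuadraticForm A M) (l.length : ZMod 2) := by
  induction l with
  | nil => exact SetLike.one_mem_graded (CliffordAlgebra.evenOdd (0 : QuadraticForm A M))
  | cons v l ih =>
    rw [List.map_cons, List.prod_cons, List.length_cons, Nat.cast_succ, add_comm]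
    exact SetLike.mul_mem_graded (CliffordAlgebra.ι_mem_evenOdd_one 0 v) ih

end ExteriorBasis

/-! ### Weights of the local operators -/

section Operators

/-- On the surviving subgroup `u = q⁻² z ^ (N + 1)`, so the scaling `q² z⁻¹ u` of `β` collapses to
`z ^ N`. -/
theorem obsRep_apply (N : ℕ) (s : Symmetry) (x : Obs) : obsRep N s x =
    obsAct ((s.2.1 : ℂ) • (s.1 : Matrix (Fin 2) (Fin 2) ℂ)) (s.2.2 : ℂ) ((s.2.2 : ℂ) ^ N) x := by
  have e : ((s.2.1 : ℂ) ^ 2 * (s.2.2 : ℂ)⁻¹ * (((s.2.1 ^ 2)⁻¹ * s.2.2 ^ (N + 1) : Circle) : ℂ)) =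
      (s.2.2 : ℂ) ^ N := by
    have h₁ := s.2.1.coe_ne_zero
    have h₂ := s.2.2.coe_ne_zero
    simp only [Circle.coe_mul, Circle.coe_inv, Circle.coe_pow]
    field_simp
    ring
  rw [← e]
  rfl

theorem obsRep_torus (N : ℕ) (p q z : Circle) (x : Obs) : obsRep N (cartan p, q, z) x =
    obsAct ((q : ℂ) • (cartan p : Matrix (Fin 2) (Fin 2) ℂ)) (z : ℂ) ((z : ℂ) ^ N) x :=
  obsRep_apply N _ x

theorem obsRep_mul (N : ℕ) (s : Symmetry) (x y : Obs) :
    obsRep N s (x * y) = obsRep N s x * obsRep N s y := by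
  simp only [obsRep_apply, map_mul]

theorem obsRep_one (N : ℕ) (s : Symmetry) : obsRep N s 1 = 1 := by
  simp only [obsRep_apply, map_one]

theorem one_mem_weightSpace (N : ℕ) : (1 : Obs) ∈ weightSpace (obsRep N) 0 0 0 := by
  intro p q z
  rw [obsRep_one]
  simp

/-- The group acts by ring endomorphisms, so weights add under products; those of monomials follow
from those of `γₙ` and `βₙ`. -/
theorem mul_mem_weightSpace {N : ℕ} {j m k j' m' k' : ℤ} {x y : Obs}
    (hx : x ∈ weightSpace (obsRep N) j m k) (hy : y ∈ weightSpace (obsRep N) j' m' k') :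
    x * y ∈ weightSpace (obsRep N) (j + j') (m + m') (k + k') := by
  intro p q z
  rw [obsRep_mul, hx, hy, smul_mul_smul_comm]
  congr 1
  simp only [zpow_add, Circle.coe_mul]
  ring

/-- Operators of weight `w`. -/
noncomputable def obsWeight (N : ℕ) (w : ℤ × ℕ × ℕ) : Submodule ℂ Obs :=
  weightSpace (obsRep N) w.1 w.2.1 w.2.2

theorem one_mem_obsWeight (N : ℕ) : (1 : Obs) ∈ obsWeight N 0 := one_mem_weightSpace N

theorem mul_mem_obsWeight {N : ℕ} {w w' : ℤ × ℕ × ℕ} {x y : Obs} (hx : x ∈ obsWeight N w)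
    (hy : y ∈ obsWeight N w') : x * y ∈ obsWeight N (w + w') := by
  have := mul_mem_weightSpace hx hy
  rw [obsWeight, Prod.fst_add, Prod.snd_add, Prod.fst_add, Prod.snd_add, Nat.cast_add,
    Nat.cast_add]
  exact this

theorem pow_mem_obsWeight {N : ℕ} {w : ℤ × ℕ × ℕ} {x : Obs} (hx : x ∈ obsWeight N w) (i : ℕ) :
    x ^ i ∈ obsWeight N (i • w) := by
  induction i with
  | zero => rw [pow_zero, zero_smul]; exact one_mem_obsWeight N
  | succ i ih => rw [pow_succ, succ_nsmul]; exact mul_mem_obsWeight ih hx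

theorem list_prod_mem_obsWeight {N : ℕ} {ι : Type*} {x : ι → Obs} {w : ι → ℤ × ℕ × ℕ}
    (hx : ∀ i, x i ∈ obsWeight N (w i)) (l : List ι) :
    (l.map x).prod ∈ obsWeight N (l.map w).sum := by
  induction l with
  | nil => exact one_mem_obsWeight N
  | cons i l ih =>
    rw [List.map_cons, List.map_cons, List.prod_cons, List.sum_cons]
    exact mul_mem_obsWeight (hx i) ih

/-- The matrix is diagonal with entries `q p` and `q p⁻¹`, which rescale `∂₁` and `∂₂` separately.
-/
theorem coordChange_cartan (p q : Circle) (n : Fin 2 →₀ ℕ) :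
    coordChange ((q : ℂ) • (cartan p : Matrix (Fin 2) (Fin 2) ℂ)) (MvPolynomial.monomial n 1) =
      ((p ^ ((n 0 : ℤ) - n 1) * q ^ ((n 0 + n 1 : ℕ) : ℤ) : Circle) : ℂ) •
        MvPolynomial.monomial n 1 := by
  have hp : (p : ℂ) ≠ 0 := p.coe_ne_zero
  have hX : ∀ j, coordChange ((q : ℂ) • (cartan p : Matrix (Fin 2) (Fin 2) ℂ))
      (MvPolynomial.X j) = ((q : ℂ) * (![(p : ℂ), ((p⁻¹ : Circle) : ℂ)] j)) •
        MvPolynomial.X j := by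
    intro j
    rw [coordChange_X]
    fin_cases j <;> simp [cartan, Fin.sum_univ_two]
  have hn : (MvPolynomial.monomial n 1 : DiffOp) =
      MvPolynomial.X 0 ^ n 0 * MvPolynomial.X 1 ^ n 1 := by
    rw [MvPolynomial.monomial_eq, Finsupp.prod_fintype _ _ fun _ => pow_zero _,
      Fin.prod_univ_two, MvPolynomial.C_1, one_mul]
  rw [hn, map_mul, map_pow, map_pow, hX, hX, smul_pow, smul_pow, smul_mul_smul_comm]
  congr 1
  simp only [Matrix.cons_val_zero, Matrix.cons_val_one, Circle.coe_mul, Circle.coe_inv,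
    Circle.coe_zpow, Circle.coe_pow, zpow_natCast, zpow_sub₀ hp, mul_pow, pow_add, inv_pow]
  field_simp

/-- The operator `γₙ`. -/
noncomputable def gammaObs (n : Fin 2 →₀ ℕ) : Obs :=
  algebraMap GammaAlg Obs (MvPolynomial.X n)

/-- The operator `βₙ`. -/
noncomputable def betaObs (n : Fin 2 →₀ ℕ) : Obs :=
  ExteriorAlgebra.ι GammaAlg (Finsupp.single n 1 : BetaMod)

theorem torus_scalar (p q z : Circle) (k : ℕ) (n : Fin 2 →₀ ℕ) :
    (z : ℂ) ^ k * ((p ^ ((n 0 : ℤ) - n 1) * q ^ ((n 0 + n 1 : ℕ) : ℤ) : Circle) : ℂ) =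
      ((p ^ (jetWeight k n).1 * q ^ ((jetWeight k n).2.1 : ℤ) *
        z ^ ((jetWeight k n).2.2 : ℤ) : Circle) : ℂ) := by
  simp only [jetWeight, Circle.coe_mul, Circle.coe_zpow, Circle.coe_pow, zpow_natCast]
  ring

theorem gammaObs_mem_obsWeight (N : ℕ) (n : Fin 2 →₀ ℕ) :
    gammaObs n ∈ obsWeight N (jetWeight 1 n) := by
  intro p q z
  rw [obsRep_torus, gammaObs, obsAct, exteriorMap_algebraMap, ← torus_scalar, pow_one]
  change algebraMap GammaAlg Obs (gammaAct _ _ _) = _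
  rw [← gammaOp_monomial, gammaAct_gammaOp, coordChange_cartan, LinearMap.map_smul, smul_smul,
    Algebra.algebraMap_eq_smul_one, Algebra.algebraMap_eq_smul_one, smul_assoc]

theorem betaObs_mem_obsWeight (N : ℕ) (n : Fin 2 →₀ ℕ) :
    betaObs n ∈ obsWeight N (jetWeight N n) := by
  intro p q z
  rw [obsRep_torus, betaObs, obsAct, exteriorMap_ι, ← torus_scalar, ← betaOp_monomial,
    betaAct_betaOp, coordChange_cartan, LinearMap.map_smul, smul_smul,
    LinearMap.map_smul_of_tower]

/-- Bases multiply along `ℂ ⊂ GammaAlg ⊂ Obs`: monomials in the `γₙ` over `ℂ`, times ordered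
products of the `βₙ` over `GammaAlg`. -/
theorem exists_obs_basis (N : ℕ) : ∃ b : Module.Basis MonomialIndex ℂ Obs,
    ∀ a, b a ∈ obsWeight N (monomialWeight N a) ∧ b a ∈ obsParity (a.2.card : ZMod 2) := by
  obtain ⟨B, hB⟩ := exists_exteriorAlgebra_basis
    (Finsupp.basisSingleOne : Module.Basis (Fin 2 →₀ ℕ) GammaAlg BetaMod)
  refine ⟨(MvPolynomial.basisMonomials (Fin 2 →₀ ℕ) ℂ).smulTower B, ?_⟩
  rintro ⟨a, S⟩
  obtain ⟨l, hl, hBl⟩ := hB S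
  rw [Module.Basis.smulTower_apply, MvPolynomial.coe_basisMonomials]
  dsimp only
  rw [hBl]
  constructor
  · rw [Algebra.smul_def]
    refine mul_mem_obsWeight ?_ ?_
    · rw [MvPolynomial.monomial_eq, MvPolynomial.C_1, one_mul, Finsupp.prod,
        ← Finset.prod_map_toList, map_list_prod, List.map_map, Finsupp.sum,
        ← Finset.sum_map_toList]
      refine list_prod_mem_obsWeight (fun n => ?_) _
      rw [Function.comp_apply, map_pow]
      exact pow_mem_obsWeight (gammaObs_mem_obsWeight N n) _
    · have h : ∑ n ∈ S, jetWeight N n = (l.map (jetWeight N)).sum := by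
        rw [Finset.sum_eq_multiset_sum, ← hl, Multiset.map_coe, Multiset.sum_coe]
      rw [h]
      refine list_prod_mem_obsWeight (fun n => ?_) _
      rw [Finsupp.coe_basisSingleOne]
      exact betaObs_mem_obsWeight N n
  · have h : S.card = (l.map (Finsupp.basisSingleOne :
        Module.Basis (Fin 2 →₀ ℕ) GammaAlg BetaMod)).length := by
      rw [List.length_map, Finset.card, ← hl, Multiset.coe_card]
    have hmap : l.map (fun i => ExteriorAlgebra.ι GammaAlg
        ((Finsupp.basisSingleOne : Module.Basis (Fin 2 →₀ ℕ) GammaAlg BetaMod) i)) =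
        (l.map (Finsupp.basisSingleOne : Module.Basis (Fin 2 →₀ ℕ) GammaAlg BetaMod)).map
          (ExteriorAlgebra.ι GammaAlg) := by
      rw [List.map_map]; rfl
    rw [h, hmap]
    exact Submodule.smul_mem (CliffordAlgebra.evenOdd (0 : QuadraticForm GammaAlg BetaMod) _) _
      (list_prod_ι_mem_evenOdd _)

theorem hasCharacter_obsRep (N : ℕ) :
    HasCharacter (obsRep N) obsParity (signedCount N Set.univ) := by
  obtain ⟨b, hb⟩ := exists_obs_basis N
  refine HasCharacter.of_basis ?_ ?_ b (monomialWeight N) (fun a => (a.2.card : ZMod 2))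
    (fun a => (hb a).1) (fun a => (hb a).2) ?_ (coeff_coeff_signedCount_univ N)
  -- The even and odd parts are complementary as `GammaAlg`-submodules; the same decomposition is
  -- transferred to `ℂ`-subspaces.
  · have h := CliffordAlgebra.evenOdd_isCompl (0 : QuadraticForm GammaAlg BetaMod)
    constructor
    · rw [Submodule.disjoint_def]
      exact fun x h0 h1 => Submodule.disjoint_def.mp h.disjoint x h0 h1
    · rw [codisjoint_iff, eq_top_iff]
      rintro x -
      obtain ⟨y, hy, z, hz, rfl⟩ := Submodule.mem_sup.mp
        ((codisjoint_iff.mp h.codisjoint).symm ▸ Submodule.mem_top : x ∈ _)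
      exact Submodule.add_mem_sup hy hz
  · intro s i x hx
    rw [Submodule.mem_comap, obsRep_apply]
    exact exteriorMap_mem_evenOdd _ _ i hx
  · intro w
    refine (finite_monomialWeight_snd N w.2.1 w.2.2).subset fun a ha => ?_
    exact congrArg Prod.snd ha

end Operators

end HolomorphicTwist

/-! ### The characters of operators and of cohomology -/

theorem proposition6p3 (N : ℕ) (W : Polynomial ℂ)
    (hW : HolomorphicTwist.IsHomogeneous W (N + 1)) :
    Multipliable (HolomorphicTwist.characterFactor N) ∧
      HolomorphicTwist.HasCharacter (HolomorphicTwist.obsRep N) HolomorphicTwist.obsParity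
        (∏' x, HolomorphicTwist.characterFactor N x) ∧
      HolomorphicTwist.HasCharacter (HolomorphicTwist.cohomologyRep W N hW)
        (HolomorphicTwist.cohomologyParity W)
        (∏' x, HolomorphicTwist.characterFactor N x) := by
  have hprod := HolomorphicTwist.hasProd_characterFactor N
  rw [hprod.tprod_eq]
  have hobs := HolomorphicTwist.hasCharacter_obsRep N
  refine ⟨hprod.multipliable, hobs, ?_⟩
  -- Homogeneity of `W` enters only through equivariance of the differential; its vanishing square
  -- and its oddness hold for every `W`.
  refine hobs.cohomology (d := HolomorphicTwist.sInt W)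
    (Q := Submodule.mkQ ((LinearMap.range (HolomorphicTwist.sInt W)).comap
      (LinearMap.ker (HolomorphicTwist.sInt W)).subtype))
    (HolomorphicTwist.sInt_sInt W) (HolomorphicTwist.sInt_obsRep hW)
    (fun i x hx => HolomorphicTwist.contractLeft_mem_evenOdd _ i hx)
    (Submodule.mkQ_surjective _) (fun x => ?_) (fun s x y hxy => ?_)
  · exact (Submodule.Quotient.mk_eq_zero _).trans Iff.rfl
  · exact congrArg Submodule.Quotient.mk (Subtype.ext hxy.symm)
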